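/- **Setting.** A Stackelberg security game with $n\ge 1$ targets consists of a nonempty closed convex set $\mathcal X\subseteq[0,1]^n$ that is downward closed ($x\in\mathcal X$, $0\le x'\le x$ imply $x'\in\mathcal X$), and, for each target $y\in\mathcal Y=\{1,\dots,n\}$, a strictly increasing continuous $u^y:[0,1]\to[0,1]$ and a strictly decreasing continuous $v^y:[0,1]\to[0,1]$; put $u(x,y)=u^y(x_y)$, $v(x,y)=v^y(x_y)$ and $\mathrm{BR}(x)=\arg\max_{y}v(x,y)$. Let $C\ge 1$ and $W>0$ be such that $\frac1C\le\frac{v^y(s)-v^y(t)}{t-s}\le C$ and $0<\frac{u^y(t)-u^y(s)}{t-s}\le C$ for all $y$ and $0\le s<t\le1$, and such that every nonempty $K_y=\{x\in\mathcal X: y\in\mathrm{BR}(x)\}$ satisfies $\max_{x\in K_y}x_y-\min_{x\in K_y}x_y\ge W$. Assume $Cn/W\ge 2$ (automatic if $n\ge2$). Let $0<\gamma<1$ and $T_\gamma=\frac1{1-\gamma}$. In each of $T$ rounds the principal plays $x^{(t)}\in\mathcal X$ as a function $\mathcal A$ of the history of the previous rounds, and the agent, seeing the history and $x^{(t)}$,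 attacks a (possibly random) target $y_t$. The agent is *$\gamma$-discounting* if, knowing $u$, $v$, $T$ and $\mathcal A$, it uses a policy $\mathcal B$ that maximizes $\mathbb E\big[\sum_{t=1}^T\gamma^t v(x^{(t)},y_t)\big]$ over all agent policies. The Stackelberg regret is $$R_{\mathcal A,\mathcal B}(T)=\max_{x\in\mathcal X}\ \mathbb E\Big[\sum_{t=1}^T\Big(\max_{y\in \mathrm{BR}(x)}u(x,y)-u(x^{(t)},y_t)\Big)\Big].$$ **Clinch** (accuracy $\delta$, bounds $\underline x\le\overline x$). Put $\lambda'=\frac{\delta}{4C^2}$, $\varepsilon=\frac{\delta}{33C^3n}$, $S=\mathcal X$, $\mathcal R=\mathcal Y$. Repeat: for all $y'$ with $\underline x+\lambda'\mathbf e_{y'}\notin S$, remove $y'$ from $\mathcal R$ and set $\overline x_{y'}\gets\underline x_{y'}$; set $S\gets\{x'\in\mathcal X:\underline x\le x'\le\overline x\}$; query the centroid $x$ of $S$ (the mean of the uniform distribution on $S$ within its affine hull), receive a target $y$, and set $\underline x_y\gets\max\{\underline x_y,\,x_y-C\varepsilon\}$; stop once $y\notin\mathcal R$. Then, for $y=1,\dots,n$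 in turn: start with $\ell=\underline x_y$, $r=x_y$; while $r-\ell\ge\lambda'$, put $m=\frac{\ell+r}2$, query $x+(m-x_y)\mathbf e_y$, and set $\ell\gets m$ if the response is $y$, $r\gets m$ otherwise; finally set $\hat x_y=\ell$. Return $\hat x$. **Perturb**$(\hat x,\lambda)=\hat x-\frac{W\lambda}2\mathbf e_{\hat y}$, where $\hat y$ is a maximizer of $u(\hat x,\cdot)$ over $\{y:\hat x_y>W/2\}$ ($\hat x$ is left unchanged if this set is empty). **BatchedClinch** (which knows $\mathcal X,u,C,W,\gamma,T$ but not $v$). Start with $\tilde x=0$ and box $B=[0,1]^n$. For epochs $\phi=1,\dots,\lceil\log_2T\rceil$, with $\lambda=2^{-\phi}/C$ and $\delta=\frac{W\lambda}{6C^2}$: run Clinch with accuracy $\delta$ and the lower and upper corners of $B$ as bounds, in batches, each consisting of one round in which Clinch's next query is played and the attacked target is returned to Clinch as the response, followed by $\big\lceil T_\gamma\log\frac{200\,T_\gamma C^5n}{W\lambda}\big\rceil$ rounds in which $\tilde x$ is played; when Clinch has returned $\hat x$ and the batch is over, set $\tilde x\gets\mathrm{Perturb}(\hat x,\lambda)$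 and $B\gets\{x\in[0,1]^n:\|x-\hat x\|_\infty\le\delta\}$. After the last epoch play $\tilde x$ in all remaining rounds. (Play stops after round $T$ in any case.) **Theorem.** There is an absolute constant $K>0$ such that, for all games and parameters as above, BatchedClinch always plays strategies in $\mathcal X$, and its Stackelberg regret over $T$ rounds against every $\gamma$-discounting agent is at most $$K\Big(n\log\frac{Cn}{W}\,\log T+n\,T_\gamma\log^2\frac{CnT_\gamma}{W}\Big).$$ -/

import Mathlib

open Set MeasureTheory

noncomputable section

namespace SecurityGame

/-! ### Repeated play between a principal and an agent -/

/-- A coverage vector: target `y` is defended with probability `x y`. -/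
abbrev Strategy (n : ℕ) : Type := Fin n → ℝ

/-- A history: the pairs (strategy, attacked target) of the past rounds, in chronological order. -/
abbrev History (n : ℕ) : Type := List (Strategy n × Fin n)

/-- A (deterministic) principal policy. -/
abbrev PrincipalPolicy (n : ℕ) : Type := History n → Strategy n

/-- A possibly random agent policy: after a history and the principal's current strategy it
attacks according to a probability vector on the targets. -/
abbrev AgentPolicy (n : ℕ) : Type := History n → Strategy n → stdSimplex ℝ (Fin n)

variable {n : ℕ}

/-- Payoffs depend only on the attacked target and on how far it is defended. -/
def payoff (w : Fin n → ℝ → ℝ) (x : Strategy n) (y : Fin n) : ℝ := w y (x y)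

/-- The expectation of `f` of the random history of the first `t` rounds, when the principal
plays `A` and the agent plays `B`. -/
def expect (A : PrincipalPolicy n) (B : AgentPolicy n) : ℕ → (History n → ℝ) → ℝ
  | 0, f => f []
  | t + 1, f => expect A B t
      (fun H => ∑ y : Fin n, (B H (A H)).1 y * f (H ++ [(A H, y)]))

/-- The agent's discounted utility of a history, the `t`-th round being weighted by `γ ^ t`
(rounds are counted from 1). -/
def agentUtility (γ : ℝ) (v : Fin n → ℝ → ℝ) (H : History n) : ℝ :=
  ∑ t : Fin H.length, γ ^ ((t : ℕ) + 1) * payoff v (H.get t).1 (H.get t).2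

/-- `B` is a policy of a rational `γ`-discounting agent facing the principal policy `A` over
`T` rounds: no agent policy has larger expected discounted utility. -/
def IsRational (γ : ℝ) (v : Fin n → ℝ → ℝ) (A : PrincipalPolicy n) (T : ℕ)
    (B : AgentPolicy n) : Prop :=
  ∀ B' : AgentPolicy n,
    expect A B' T (agentUtility γ v) ≤ expect A B T (agentUtility γ v)

/-- The agent's best responses to `x`. -/
def bestResponses (v : Fin n → ℝ → ℝ) (x : Strategy n) : Set (Fin n) :=
  {y | ∀ y', payoff v x y' ≤ payoff v x y}

/-- The principal's payoff for `x` if the agent best responds and breaks ties in favour of the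
principal. -/
def stageValue (u v : Fin n → ℝ → ℝ) (x : Strategy n) : ℝ :=
  sSup (payoff u x '' bestResponses v x)

/-- Stackelberg regret over `T` rounds. -/
def stackelbergRegret (X : Set (Strategy n)) (u v : Fin n → ℝ → ℝ) (A : PrincipalPolicy n)
    (B : AgentPolicy n) (T : ℕ) : ℝ :=
  ⨆ x : X, expect A B T (fun H =>
    ∑ t : Fin H.length, (stageValue u v x - payoff u (H.get t).1 (H.get t).2))

/-! ### Stackelberg security games and their regularity -/

/-- `(X, u, v)` is a Stackelberg security game with `n` targets. -/
structure IsSecurityGame (X : Set (Strategy n)) (u v : Fin n → ℝ → ℝ) : Prop where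
  nonempty : X.Nonempty
  mem_cube : ∀ x ∈ X, ∀ y, x y ∈ Icc (0 : ℝ) 1
  isClosed : IsClosed X
  convex : Convex ℝ X
  downward : ∀ x ∈ X, ∀ x' : Strategy n, 0 ≤ x' → x' ≤ x → x' ∈ X
  u_mapsTo : ∀ y, MapsTo (u y) (Icc 0 1) (Icc 0 1)
  u_continuousOn : ∀ y, ContinuousOn (u y) (Icc 0 1)
  u_strictMonoOn : ∀ y, StrictMonoOn (u y) (Icc 0 1)
  v_mapsTo : ∀ y, MapsTo (v y) (Icc 0 1) (Icc 0 1)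
  v_continuousOn : ∀ y, ContinuousOn (v y) (Icc 0 1)
  v_strictAntiOn : ∀ y, StrictAntiOn (v y) (Icc 0 1)

/-- The strategies to which `y` is a best response. -/
def bestResponseRegion (X : Set (Strategy n)) (v : Fin n → ℝ → ℝ) (y : Fin n) :
    Set (Strategy n) :=
  {x | x ∈ X ∧ y ∈ bestResponses v x}

/-- Slope bound `C` and width bound `W`: every nonempty best response region has width at
least `W` in the direction of its target. -/
structure IsRegular (X : Set (Strategy n)) (u v : Fin n → ℝ → ℝ) (C W : ℝ) : Prop where
  one_le : 1 ≤ C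
  width_pos : 0 < W
  v_slope : ∀ y, ∀ s t : ℝ, 0 ≤ s → s < t → t ≤ 1 →
    1 / C ≤ (v y s - v y t) / (t - s) ∧ (v y s - v y t) / (t - s) ≤ C
  u_slope : ∀ y, ∀ s t : ℝ, 0 ≤ s → s < t → t ≤ 1 →
    0 < (u y t - u y s) / (t - s) ∧ (u y t - u y s) / (t - s) ≤ C
  width : ∀ y, (bestResponseRegion X v y).Nonempty →
    ∃ x ∈ bestResponseRegion X v y, ∃ x' ∈ bestResponseRegion X v y, W ≤ x y - x' y

/-! ### The search algorithm Clinch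

The algorithm is written as a machine that issues queries and is fed the responses. -/

/-- The mean of the uniform distribution on the convex set `S`, taken in the affine span of
`S`: Hausdorff measure of dimension `dim S` is there a multiple of Lebesgue measure. -/
def centroid (S : Set (Strategy n)) : Strategy n :=
  ⨍ x in S, x ∂(Measure.hausdorffMeasure (Module.finrank ℝ (vectorSpan ℝ S) : ℝ))

/-- The states of Clinch between a response and the next query. -/
inductive ClinchState (n : ℕ) : Type
  /-- In the main loop: entrywise bounds `lo`, `hi`, active targets `R`, search region `S`; the
  centroid of `S` is queried next. -/
  | minimize (lo hi : Strategy n) (R : Finset (Fin n)) (S : Set (Strategy n)) : ClinchState n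
  /-- In ConserveMass: binary search for target `y` on `[l, r]`, the targets `ys` being left;
  `xhat` holds the entries found so far. -/
  | conserve (x lo xhat : Strategy n) (y : Fin n) (ys : List (Fin n)) (l r : ℝ) : ClinchState n
  /-- Terminated with output `xhat`. -/
  | done (xhat : Strategy n) : ClinchState n

open Classical in
/-- The top of the main loop: lock the coordinates with slack less than `lam` and recompute the
search region. -/
def minimizeLoop (X : Set (Strategy n)) (lam : ℝ) (lo hi : Strategy n) (R : Finset (Fin n))
    (S : Set (Strategy n)) : ClinchState n :=
  let locked : Finset (Fin n) := Finset.univ.filter (fun y => lo + Pi.single y lam ∉ S)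
  let hi' : Strategy n := fun y => if y ∈ locked then lo y else hi y
  .minimize lo hi' (R \ locked) {x' | x' ∈ X ∧ lo ≤ x' ∧ x' ≤ hi'}

open Classical in
/-- The loop of ConserveMass over the remaining targets, up to the next query. -/
def conserveLoop (lam : ℝ) (x lo : Strategy n) : Strategy n → List (Fin n) → ClinchState n
  | xhat, [] => .done xhat
  | xhat, y :: ys =>
      if lam ≤ x y - lo y then .conserve x lo xhat y ys (lo y) (x y)
      else conserveLoop lam x lo (Function.update xhat y (lo y)) ys

/-- The tolerance `λ = δ / (4 C²)` used by Clinch with target accuracy `δ`. -/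
def clinchTol (C δ : ℝ) : ℝ := δ / (4 * C ^ 2)

/-- The accuracy `ε = δ / (33 C³ n)` of the best responses that Clinch expects. -/
def clinchEps (n : ℕ) (C δ : ℝ) : ℝ := δ / (33 * C ^ 3 * n)

/-- Clinch with target accuracy `δ` and entrywise bounds `lo`, `hi`, before its first query. -/
def clinchInit (X : Set (Strategy n)) (C δ : ℝ) (lo hi : Strategy n) : ClinchState n :=
  minimizeLoop X (clinchTol C δ) lo hi Finset.univ X

/-- The next query. (The value at a terminated state is never used.) -/
def clinchQuery : ClinchState n → Strategy n
  | .minimize _ _ _ S => centroid S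
  | .conserve x _ _ y _ l r => Function.update x y ((r + l) / 2)
  | .done xhat => xhat

open Classical in
/-- The state after the response `z` to the current query. -/
def clinchRespond (X : Set (Strategy n)) (C δ : ℝ) (s : ClinchState n) (z : Fin n) :
    ClinchState n :=
  match s with
  | .minimize lo hi R S =>
      let x := centroid S
      let lo' := Function.update lo z (max (lo z) (x z - C * clinchEps n C δ))
      if z ∈ R then minimizeLoop X (clinchTol C δ) lo' hi R S
      else conserveLoop (clinchTol C δ) x lo' x (List.finRange n)
  | .conserve x lo xhat y ys l r =>
      let m := (r + l) / 2
      let l' := if z = y then m else l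
      let r' := if z = y then r else m
      if clinchTol C δ ≤ r' - l' then .conserve x lo xhat y ys l' r'
      else conserveLoop (clinchTol C δ) x lo (Function.update xhat y l') ys
  | .done xhat => .done xhat

/-! ### The policy BatchedClinch -/

open Classical in
/-- `xhat - (W λ / 2) e_ŷ`, where `ŷ` is an arbitrary maximiser of `u(xhat, y)` among the
targets with `xhat y > W / 2` (and `xhat` itself if there is no such target). -/
def perturb (u : Fin n → ℝ → ℝ) (W : ℝ) (xhat : Strategy n) (lam : ℝ) : Strategy n :=
  if h : ∃ y, W / 2 < xhat y ∧ ∀ y', W / 2 < xhat y' → payoff u xhat y' ≤ payoff u xhat y then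
    xhat - Pi.single h.choose (W * lam / 2)
  else xhat

/-- The discounted time horizon `T_γ`. -/
def discountHorizon (γ : ℝ) : ℝ := 1 / (1 - γ)

/-- The parameter `λ = 2 ^ (-φ) / C` of epoch `φ`. -/
def epochLam (C : ℝ) (φ : ℕ) : ℝ := 1 / (C * 2 ^ φ)

/-- The accuracy `δ = W λ / (6 C²)` of epoch `φ`. -/
def epochDelta (C W : ℝ) (φ : ℕ) : ℝ := W * epochLam C φ / (6 * C ^ 2)

/-- The number of exploit rounds after each explore round of epoch `φ`. -/
def exploitLength (n : ℕ) (C W γ : ℝ) (φ : ℕ) : ℕ :=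
  ⌈discountHorizon γ *
    Real.log (200 * discountHorizon γ * C ^ 5 * n / (W * epochLam C φ))⌉₊

/-- The state of BatchedClinch between two rounds: current epoch, state of the current run of
Clinch, current exploit strategy, and number of exploit rounds left in the current batch. -/
structure BatchState (n : ℕ) : Type where
  epoch : ℕ
  run : ClinchState n
  exploit : Strategy n
  wait : ℕ

/-- Start of epoch 1. -/
def batchInit (X : Set (Strategy n)) (C W : ℝ) : BatchState n where
  epoch := 1
  run := clinchInit X C (epochDelta C W 1) 0 1
  exploit := 0
  wait := 0

/-- At the end of a batch, if Clinch has terminated with output `xhat`, update the exploit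
strategy and start the next epoch with the box `{x ∈ [0,1]^n : ‖x - xhat‖_∞ ≤ δ}`. -/
def batchFinish (X : Set (Strategy n)) (u : Fin n → ℝ → ℝ) (C W : ℝ) (s : BatchState n) :
    BatchState n :=
  match s.wait, s.run with
  | 0, .done xhat =>
      { epoch := s.epoch + 1
        run := clinchInit X C (epochDelta C W (s.epoch + 1))
          (fun y => max (xhat y - epochDelta C W s.epoch) 0)
          (fun y => min (xhat y + epochDelta C W s.epoch) 1)
        exploit := perturb u W xhat (epochLam C s.epoch)
        wait := 0 }
  | _, _ => s

/-- The state after a round in which target `z` was attacked. There are `⌈log₂ T⌉` epochs. -/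
def batchRespond (X : Set (Strategy n)) (u : Fin n → ℝ → ℝ) (C W γ : ℝ) (T : ℕ)
    (s : BatchState n) (z : Fin n) : BatchState n :=
  if Nat.clog 2 T < s.epoch then s
  else if s.wait = 0 then
    batchFinish X u C W
      { s with
        run := clinchRespond X C (epochDelta C W s.epoch) s.run z
        wait := exploitLength n C W γ s.epoch }
  else batchFinish X u C W { s with wait := s.wait - 1 }

/-- The strategy played in the next round. -/
def batchPlay (T : ℕ) (s : BatchState n) : Strategy n :=
  if Nat.clog 2 T < s.epoch ∨ s.wait ≠ 0 then s.exploit else clinchQuery s.run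

/-- The policy BatchedClinch. It uses `X`, `u`, `C`, `W`, `γ`, `T` and the observed attacks,
but not the agent's payoffs. -/
def batchedClinch (X : Set (Strategy n)) (u : Fin n → ℝ → ℝ) (C W γ : ℝ) (T : ℕ) :
    PrincipalPolicy n := fun H =>
  batchPlay T (H.foldl (fun s p => batchRespond X u C W γ T s p.2) (batchInit X C W))

end SecurityGame

end

/-!
Let `V* = min over x ∈ X of max over y of v(x, y)`. The conservative strategy `xs` attains `V*` and
defends no target more than that requires (`exists_conservative`). If `y` is a best response to
`x ∈ X`, then `v(x, y) ≥ V*`, hence `x y ≤ xs y`; so no commitment is worth more to the principal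
than `xs` with ties broken in the principal's favour (`IsConservative.stageValue_le`), and the width
condition makes every best response to `xs` satisfy `xs y ≥ W`. Near `xs`, lowering the defence of
the best such target by `W λ / 2` makes it the unique best response, so the perturbed strategy has
regret at most `C W λ` whatever a best responding agent does (`IsConservative.perturb_regret`).

A rational discounting agent solves a dynamic program, and every attack of positive probability is
optimal in it (`IsRational.action_optimal`). BatchedClinch ignores the responses of the exploit
rounds, which are therefore exact best responses; a response in an explore round influences the play
only after the batch, and all later utility is discounted to at most `ε` times the weight of the
explore round, so that the response is an `ε`-best response (`IsRational.truthful`).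

Given `ε`-best responses, Clinch keeps `lo ≤ xs`, and `xs y ≤ lo y + λ'` for locked targets. A
response to a locked target proves that the agent's payoff is almost `V*`, whence `x` almost
dominates `xs`, and the binary searches then remove the superfluous defence
(`clinchRespond_accurate`). The number of queries is bounded by a volume argument. The search region
is a convex body that is downward closed above `lo`. Its dimension drops when targets are locked, so
it is thickened in the locked coordinates to a body of dimension `n`, the mean of which agrees with
the centroid in the free coordinates. Since the body is downward closed, the slabs of a given
thickness orthogonal to a coordinate axis have decreasing volume; together with Markov's inequality
this shows that a cut near the centroid removes a constant fraction of the volume, without the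
Grünbaum inequality (`CornerBody.volume_above_half_mean`). A lock increases the volume by a factor
of at most `e` per coordinate (`CornerBody.regionVolume_lock_le`), for which the factor `e ^ (2 |R|)`
in `CornerBody.potential` pays in advance.

A budget attached to the states of BatchedClinch drops in each round by at least the regret of that
round, up to `1 / T` (`batchRespond_accurate`). Its initial value is a sum over the epochs of
(number of queries) × (1 + (length of a batch) × (regret `2 ^ (1 - φ)` of the exploit strategy)),
which is summed in `sum_epochCost_le`.
-/

namespace SecurityGame

open scoped Pointwise

variable {n : ℕ}

/-! ### Rational agents solve a dynamic program -/

lemma sum_history_append (H : History n) (p : Strategy n × Fin n)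
    (f : ℕ → Strategy n × Fin n → ℝ) :
    ∑ t : Fin (H ++ [p]).length, f t ((H ++ [p]).get t)
      = ∑ t : Fin H.length, f t (H.get t) + f H.length p := by
  have hlen : (H ++ [p]).length = H.length + 1 := by simp
  rw [← Equiv.sum_comp (finCongr hlen.symm), Fin.sum_univ_castSucc]
  simp

lemma agentUtility_append (γ : ℝ) (v : Fin n → ℝ → ℝ) (H : History n)
    (p : Strategy n × Fin n) :
    agentUtility γ v (H ++ [p])
      = agentUtility γ v H + γ ^ (H.length + 1) * payoff v p.1 p.2 :=
  sum_history_append H p fun t q => γ ^ (t + 1) * payoff v q.1 q.2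

/-- The largest discounted utility that an agent can collect against `A` in the `k` rounds after
the history `H`. Rounds are numbered, and hence discounted, from the beginning of `H`. -/
noncomputable def continuationValue (γ : ℝ) (v : Fin n → ℝ → ℝ) (A : PrincipalPolicy n) :
    ℕ → History n → ℝ
  | 0, _ => 0
  | k + 1, H => ⨆ y : Fin n, (γ ^ (H.length + 1) * payoff v (A H) y +
      continuationValue γ v A k (H ++ [(A H, y)]))

/-- The histories that have positive probability when `A` faces `B`. -/
inductive OnPath (A : PrincipalPolicy n) (B : AgentPolicy n) : History n → Prop
  | nil : OnPath A B []
  | snoc (H : History n) (y : Fin n) : OnPath A B H → 0 < (B H (A H)).1 y →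
      OnPath A B (H ++ [(A H, y)])

section

variable {A : PrincipalPolicy n} {B : AgentPolicy n}

lemma expect_mono_onPath {t : ℕ} {f g : History n → ℝ}
    (h : ∀ H, OnPath A B H → H.length = t → f H ≤ g H) : expect A B t f ≤ expect A B t g := by
  induction t generalizing f g with
  | zero => exact h [] .nil rfl
  | succ t ih =>
    refine ih fun H hH hl => Finset.sum_le_sum fun y _ => ?_
    rcases ((B H (A H)).2.1 y).eq_or_lt with h0 | h0
    · simp [← h0]
    · exact mul_le_mul_of_nonneg_left (h _ (.snoc H y hH h0) (by simp [hl])) h0.le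

lemma expect_lt_onPath {H₀ : History n} (h₀ : OnPath A B H₀) {f g : History n → ℝ}
    (h : ∀ H, f H ≤ g H) (hlt : f H₀ < g H₀) :
    expect A B H₀.length f < expect A B H₀.length g := by
  induction h₀ generalizing f g with
  | nil => exact hlt
  | snoc H y _ hy ih =>
    rw [List.length_append]
    refine ih (fun H' => Finset.sum_le_sum fun y' _ =>
      mul_le_mul_of_nonneg_left (h _) ((B H' (A H')).2.1 y')) ?_
    exact Finset.sum_lt_sum
      (fun y' _ => mul_le_mul_of_nonneg_left (h _) ((B H (A H)).2.1 y'))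
      ⟨y, Finset.mem_univ _, mul_lt_mul_of_pos_left hlt hy⟩

lemma expect_const (t : ℕ) (c : ℝ) : expect A B t (fun _ => c) = c := by
  induction t with
  | zero => rfl
  | succ t ih =>
    have : (fun H : History n => ∑ y : Fin n, (B H (A H)).1 y * c) = fun _ => c := by
      funext H
      rw [← Finset.sum_mul, (B H (A H)).2.2, one_mul]
    simp only [expect, this, ih]

variable {γ : ℝ} {v : Fin n → ℝ → ℝ}

lemma action_le_continuationValue (k : ℕ) (H : History n) (y : Fin n) :
    γ ^ (H.length + 1) * payoff v (A H) y + continuationValue γ v A k (H ++ [(A H, y)])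
      ≤ continuationValue γ v A (k + 1) H :=
  le_ciSup (f := fun y => γ ^ (H.length + 1) * payoff v (A H) y +
    continuationValue γ v A k (H ++ [(A H, y)])) (Set.finite_range _).bddAbove y

/-- Past utility plus future value drops, in the mean over the next action, by the mean
suboptimality of that action. -/
lemma mean_action_eq (B : AgentPolicy n) (k : ℕ) (H : History n) :
    ∑ y, (B H (A H)).1 y * (agentUtility γ v (H ++ [(A H, y)]) +
        continuationValue γ v A k (H ++ [(A H, y)]))
      = agentUtility γ v H + continuationValue γ v A (k + 1) H -
        ∑ y, (B H (A H)).1 y * (continuationValue γ v A (k + 1) H -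
          (γ ^ (H.length + 1) * payoff v (A H) y +
            continuationValue γ v A k (H ++ [(A H, y)]))) := by
  have h1 : ∑ y, (B H (A H)).1 y = 1 := (B H (A H)).2.2
  have : agentUtility γ v H + continuationValue γ v A (k + 1) H
      = ∑ y, (B H (A H)).1 y * (agentUtility γ v H + continuationValue γ v A (k + 1) H) := by
    rw [← Finset.sum_mul, h1, one_mul]
  rw [this, ← Finset.sum_sub_distrib]
  refine Finset.sum_congr rfl fun y _ => ?_
  rw [agentUtility_append]
  ring

lemma mean_deficit_nonneg (B : AgentPolicy n) (k : ℕ) (H : History n) :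
    0 ≤ ∑ y, (B H (A H)).1 y * (continuationValue γ v A (k + 1) H -
          (γ ^ (H.length + 1) * payoff v (A H) y +
            continuationValue γ v A k (H ++ [(A H, y)]))) :=
  Finset.sum_nonneg fun y _ => mul_nonneg ((B H (A H)).2.1 y)
    (sub_nonneg.2 (action_le_continuationValue k H y))

lemma expect_succ_le (B : AgentPolicy n) (t k : ℕ) :
    expect A B (t + 1) (fun H => agentUtility γ v H + continuationValue γ v A k H)
      ≤ expect A B t (fun H => agentUtility γ v H + continuationValue γ v A (k + 1) H) := by
  refine expect_mono_onPath (t := t) fun H _ _ => ?_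
  rw [mean_action_eq]
  exact sub_le_self _ (mean_deficit_nonneg B k H)

lemma expect_le_expect_continuationValue (B : AgentPolicy n) (t k : ℕ) :
    expect A B (t + k) (agentUtility γ v)
      ≤ expect A B t (fun H => agentUtility γ v H + continuationValue γ v A k H) := by
  induction k generalizing t with
  | zero => simp [continuationValue]
  | succ k ih =>
    have := ih (t + 1)
    rw [add_right_comm, add_assoc] at this
    exact this.trans (expect_succ_le B t k)

/-- Some deterministic policy attains the value of the dynamic program. -/
lemma exists_policy_attaining [Nonempty (Fin n)] (γ : ℝ) (v : Fin n → ℝ → ℝ)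
    (A : PrincipalPolicy n) (T : ℕ) :
    ∃ B : AgentPolicy n,
      expect A B T (agentUtility γ v) = continuationValue γ v A T [] := by
  have hex : ∀ k H, ∃ y, γ ^ (H.length + 1) * payoff v (A H) y +
      continuationValue γ v A k (H ++ [(A H, y)]) = continuationValue γ v A (k + 1) H :=
    fun k H => exists_eq_ciSup_of_finite (f := fun y => γ ^ (H.length + 1) * payoff v (A H) y +
      continuationValue γ v A k (H ++ [(A H, y)]))
  choose br hbr using hex
  let B : AgentPolicy n := fun H _ =>
    ⟨Pi.single (br (T - H.length - 1) H) 1, single_mem_stdSimplex ℝ _⟩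
  refine ⟨B, ?_⟩
  have key : ∀ k t, t + k = T → expect A B T (agentUtility γ v)
      = expect A B t (fun H => agentUtility γ v H + continuationValue γ v A k H) := by
    intro k
    induction k with
    | zero =>
      rintro t rfl
      simp [continuationValue]
    | succ k ih =>
      intro t ht
      rw [ih (t + 1) (by omega)]
      have heq : ∀ H : History n, H.length = t →
          ∑ y, (B H (A H)).1 y * (agentUtility γ v (H ++ [(A H, y)]) +
            continuationValue γ v A k (H ++ [(A H, y)]))
          = agentUtility γ v H + continuationValue γ v A (k + 1) H := by
        intro H hl
        have hk : T - H.length - 1 = k := by omega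
        rw [mean_action_eq, sub_eq_self]
        simp only [B, hk]
        rw [Finset.sum_eq_single (br k H)]
        · simp [hbr]
        · intro y _ hy
          simp [hy]
        · simp
      exact le_antisymm (expect_mono_onPath fun H _ hl => (heq H hl).le)
        (expect_mono_onPath fun H _ hl => (heq H hl).ge)
  rw [key T 0 (zero_add T)]
  simp [expect, agentUtility]

/-- A rational agent only takes actions that are optimal in the dynamic program. -/
lemma IsRational.action_optimal {T : ℕ} (hB : IsRational γ v A T B) {H : History n}
    (hH : OnPath A B H) {k : ℕ} (hk : H.length + (k + 1) = T) {y : Fin n}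
    (hy : 0 < (B H (A H)).1 y) :
    γ ^ (H.length + 1) * payoff v (A H) y + continuationValue γ v A k (H ++ [(A H, y)])
      = continuationValue γ v A (k + 1) H := by
  have : Nonempty (Fin n) := ⟨y⟩
  by_contra hne
  have hlt := (action_le_continuationValue k H y).lt_of_ne hne
  obtain ⟨B', hB'⟩ := exists_policy_attaining γ v A T
  have h1 := hB B'
  have mono : ∀ t k : ℕ, expect A B t
      (fun H => agentUtility γ v H + continuationValue γ v A k H)
      ≤ continuationValue γ v A (t + k) [] := by
    intro t
    induction t with
    | zero => intro k; simp [expect, agentUtility]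
    | succ t ih =>
      intro k
      have h2 := ih (k + 1)
      rw [show t + (k + 1) = t + 1 + k by ring] at h2
      exact (expect_succ_le B t k).trans h2
  have h3 : expect A B (H.length + 1)
      (fun H => agentUtility γ v H + continuationValue γ v A k H)
      < expect A B H.length
        (fun H => agentUtility γ v H + continuationValue γ v A (k + 1) H) := by
    refine expect_lt_onPath hH (fun H' => ?_) ?_
    · rw [mean_action_eq]
      exact sub_le_self _ (mean_deficit_nonneg B k H')
    · rw [mean_action_eq]
      have : 0 < ∑ y, (B H (A H)).1 y * (continuationValue γ v A (k + 1) H -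
          (γ ^ (H.length + 1) * payoff v (A H) y +
            continuationValue γ v A k (H ++ [(A H, y)]))) :=
        Finset.sum_pos' (fun y _ => mul_nonneg ((B H (A H)).2.1 y)
          (sub_nonneg.2 (action_le_continuationValue k H y)))
          ⟨y, Finset.mem_univ _, mul_pos hy (sub_pos.2 hlt)⟩
      linarith
  have h4 := expect_le_expect_continuationValue (A := A) (γ := γ) (v := v) B (H.length + 1) k
  have h5 := mono H.length (k + 1)
  rw [hk] at h5
  rw [show H.length + 1 + k = T by omega] at h4
  linarith

end

/-! ### The centroid of a search region -/

/-- A search region of Clinch, seen as a convex body: `S` has the least element `lo`, is downward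
closed above `lo`, is constant in the coordinates outside `R`, and has slack `lam` above `lo` in
the coordinates in `R`. -/
structure CornerBody (lo : Strategy n) (lam : ℝ) (R : Finset (Fin n)) (S : Set (Strategy n)) :
    Prop where
  lam_pos : 0 < lam
  isCompact : IsCompact S
  convex : Convex ℝ S
  lower : ∀ x ∈ S, lo ≤ x
  downward : ∀ x ∈ S, ∀ x', lo ≤ x' → x' ≤ x → x' ∈ S
  locked : ∀ x ∈ S, ∀ y ∉ R, x y = lo y
  slack : ∀ y ∈ R, lo + Pi.single y lam ∈ S
  lo_mem : lo ∈ S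

/-- The isometric embedding of `ℝ ^ R` into `ℝ ^ n` that fills up with the entries of `lo`. -/
def faceEmbed (R : Finset (Fin n)) (lo : Strategy n) (z : {y // y ∈ R} → ℝ) : Strategy n :=
  fun y => if h : y ∈ R then z ⟨y, h⟩ else lo y

/-- The full-dimensional body obtained from `S` by giving every coordinate outside `R` the
freedom of an interval of length `τ`. -/
def thicken (R : Finset (Fin n)) (lo : Strategy n) (τ : ℝ) (S : Set (Strategy n)) :
    Set (Strategy n) :=
  {x | (fun y => if y ∈ R then x y else lo y) ∈ S ∧ ∀ y ∉ R, x y ∈ Icc (lo y) (lo y + τ)}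

lemma isometry_faceEmbed (R : Finset (Fin n)) (lo : Strategy n) : Isometry (faceEmbed R lo) := by
  refine Isometry.of_dist_eq fun z w => ?_
  refine le_antisymm ((dist_pi_le_iff dist_nonneg).2 fun y => ?_)
    ((dist_pi_le_iff dist_nonneg).2 fun y => ?_)
  · by_cases h : y ∈ R
    · simpa [faceEmbed, h] using dist_le_pi_dist z w ⟨y, h⟩
    · simp [faceEmbed, h]
  · simpa [faceEmbed, y.2] using dist_le_pi_dist (faceEmbed R lo z) (faceEmbed R lo w) y

namespace CornerBody

variable {lo : Strategy n} {lam : ℝ} {R : Finset (Fin n)} {S : Set (Strategy n)}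

lemma finrank_vectorSpan (h : CornerBody lo lam R S) :
    Module.finrank ℝ (vectorSpan ℝ S) = R.card := by
  have hspan : vectorSpan ℝ S
      = Submodule.span ℝ (range fun y : R => (Pi.single (y : Fin n) 1 : Strategy n)) := by
    refine le_antisymm ?_ ?_
    · rw [vectorSpan_def, Submodule.span_le]
      rintro _ ⟨a, ha, b, hb, rfl⟩
      have : a -ᵥ b = ∑ y ∈ R, (a y - b y) • (Pi.single y 1 : Strategy n) := by
        funext j
        by_cases hj : j ∈ R
        · simp [Finset.sum_apply, Pi.single_apply, hj]
        · simp [Finset.sum_apply, Pi.single_apply, hj, h.locked a ha j hj, h.locked b hb j hj]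
      change a -ᵥ b ∈ _
      rw [this]
      exact Submodule.sum_mem _ fun y hy =>
        Submodule.smul_mem _ _ (Submodule.subset_span ⟨⟨y, hy⟩, rfl⟩)
    · rw [Submodule.span_le]
      rintro _ ⟨y, rfl⟩
      have h1 := vsub_mem_vectorSpan ℝ (h.slack y y.2) h.lo_mem
      have h2 := (vectorSpan ℝ S).smul_mem lam⁻¹ h1
      have heq : (Pi.single (y : Fin n) 1 : Strategy n)
          = lam⁻¹ • (lo + Pi.single (y : Fin n) lam -ᵥ lo) := by
        funext j
        have := h.lam_pos.ne'
        by_cases hj : j = y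
        · subst hj; simp [this]
        · simp [hj]
      change (Pi.single (y : Fin n) 1 : Strategy n) ∈ vectorSpan ℝ S
      rwa [heq]
  rw [hspan, finrank_span_eq_card]
  · simp
  · exact (Pi.basisFun ℝ (Fin n)).linearIndependent.comp (fun y : R => (y : Fin n))
      Subtype.val_injective |> fun hli => by simpa [Function.comp_def] using hli

lemma subset_range_faceEmbed (h : CornerBody lo lam R S) : S ⊆ range (faceEmbed R lo) := by
  intro x hx
  refine ⟨fun y => x y, ?_⟩
  funext y
  by_cases hy : y ∈ R
  · simp [faceEmbed, hy]
  · simp [faceEmbed, hy, h.locked x hx y hy]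

lemma centroid_eq (h : CornerBody lo lam R S) :
    centroid S = ⨍ z in faceEmbed R lo ⁻¹' S, faceEmbed R lo z := by
  have hi := isometry_faceEmbed R lo
  have hmeas : Measurable (faceEmbed R lo) := hi.continuous.measurable
  have hS : MeasurableSet S := h.isCompact.isClosed.measurableSet
  have hvol : (volume : Measure ({y // y ∈ R} → ℝ)) = Measure.hausdorffMeasure (R.card : ℝ) := by
    rw [← hausdorffMeasure_pi_real, Fintype.card_coe]
  have hmap : (Measure.hausdorffMeasure (R.card : ℝ) : Measure (Strategy n)).restrict S
      = ((volume : Measure ({y // y ∈ R} → ℝ)).restrict (faceEmbed R lo ⁻¹' S)).map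
          (faceEmbed R lo) := by
    rw [← Measure.restrict_map hmeas hS, hvol, hi.map_hausdorffMeasure (Or.inl (by positivity)),
      Measure.restrict_restrict hS, inter_eq_left.2 h.subset_range_faceEmbed]
  unfold centroid
  rw [h.finrank_vectorSpan, hmap, average_eq, average_eq,
    hi.isClosedEmbedding.measurableEmbedding.integral_map]
  congr 2
  rw [measureReal_def, Measure.map_apply hmeas MeasurableSet.univ, preimage_univ, measureReal_def]

lemma isCompact_preimage (h : CornerBody lo lam R S) : IsCompact (faceEmbed R lo ⁻¹' S) :=
  (isometry_faceEmbed R lo).isClosedEmbedding.isCompact_preimage h.isCompact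

lemma thicken_eq_preimage (R : Finset (Fin n)) (lo : Strategy n) (τ : ℝ) (S : Set (Strategy n)) :
    thicken R lo τ S = MeasurableEquiv.piEquivPiSubtypeProd (fun _ : Fin n => ℝ) (· ∈ R) ⁻¹'
      ((faceEmbed R lo ⁻¹' S) ×ˢ
        univ.pi fun y : {y // y ∉ R} => Icc (lo y) (lo y + τ)) := by
  ext x
  simp only [thicken, mem_ofPred_eq, mem_preimage, mem_prod, mem_pi, mem_univ, true_imp_iff,
    Subtype.forall]
  refine and_congr (iff_of_eq (congrArg (· ∈ S) ?_)) Iff.rfl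
  funext y
  by_cases hy : y ∈ R <;> simp [faceEmbed, hy, MeasurableEquiv.piEquivPiSubtypeProd]

lemma volume_box (R : Finset (Fin n)) (lo : Strategy n) {τ : ℝ} (hτ : 0 ≤ τ) :
    volume (univ.pi fun y : {y // y ∉ R} => Icc (lo y) (lo y + τ))
      = ENNReal.ofReal (τ ^ (n - R.card)) := by
  rw [volume_pi_pi]
  simp [Real.volume_Icc, ENNReal.ofReal_pow hτ, Fintype.card_subtype_compl]

lemma volume_thicken (R : Finset (Fin n)) (lo : Strategy n) (S : Set (Strategy n)) {τ : ℝ} (hτ : 0 ≤ τ) :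
    volume.real (thicken R lo τ S) = volume.real (faceEmbed R lo ⁻¹' S) * τ ^ (n - R.card) := by
  have hmp := volume_preserving_piEquivPiSubtypeProd (fun _ : Fin n => ℝ) (· ∈ R)
  rw [thicken_eq_preimage, measureReal_def, hmp.measure_preimage_equiv, Measure.volume_eq_prod,
    Measure.prod_prod, volume_box R lo hτ, ENNReal.toReal_mul, ENNReal.toReal_ofReal (by positivity)]
  rw [Subsingleton.elim (Subtype.fintype fun y => y ∈ R) (Finset.Subtype.fintype R)]
  rfl

lemma integral_thicken (R : Finset (Fin n)) (lo : Strategy n) (S : Set (Strategy n)) {τ : ℝ}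
    (hτ : 0 ≤ τ) (y : {y // y ∈ R}) :
    ∫ x in thicken R lo τ S, x y = (∫ z in faceEmbed R lo ⁻¹' S, z y) * τ ^ (n - R.card) := by
  have hmp := volume_preserving_piEquivPiSubtypeProd (fun _ : Fin n => ℝ) (· ∈ R)
  have h1 := hmp.setIntegral_preimage_emb (MeasurableEquiv.measurableEmbedding _)
    (fun p : ({y // y ∈ R} → ℝ) × ({y // y ∉ R} → ℝ) => p.1 y * 1)
    ((faceEmbed R lo ⁻¹' S) ×ˢ univ.pi fun y : {y // y ∉ R} => Icc (lo y) (lo y + τ))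
  rw [← thicken_eq_preimage, Measure.volume_eq_prod,
    setIntegral_prod_mul (fun z : {y // y ∈ R} → ℝ => z y) (fun _ => (1 : ℝ))] at h1
  rw [setIntegral_const, measureReal_def, volume_box R lo hτ,
    ENNReal.toReal_ofReal (by positivity)] at h1
  rw [Subsingleton.elim (Subtype.fintype fun y => y ∈ R) (Finset.Subtype.fintype R)] at h1
  simpa [MeasurableEquiv.piEquivPiSubtypeProd] using h1

/-- Convex combinations of a point `b` and the extreme points `lo + lam e_j`, and everything
between `lo` and them. -/
lemma mem_of_le (h : CornerBody lo lam R S) {J : Finset (Fin n)} (hJ : J ⊆ R) {θ : ℝ}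
    (hθ : 0 ≤ θ) (hJθ : J.card * θ ≤ 1) {b x : Strategy n} (hb : b ∈ S) (hx : lo ≤ x)
    (hxb : ∀ y, x y ≤ lo y + (1 - J.card * θ) * (b y - lo y) + if y ∈ J then θ * lam else 0) :
    x ∈ S := by
  have hmem : ∑ o ∈ Finset.insertNone J, (o.elim (1 - J.card * θ) fun _ => θ : ℝ) •
      (o.elim b fun j => lo + Pi.single j lam : Strategy n) ∈ S := by
    refine h.convex.sum_mem ?_ ?_ ?_
    · rintro (_ | j) _ <;> simp [hθ, hJθ]
    · simp
    · rintro (_ | j) hj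
      · exact hb
      · exact h.slack j (hJ (by simpa using hj))
  refine h.downward _ hmem x hx fun y => (hxb y).trans (le_of_eq ?_)
  simp only [Finset.sum_insertNone, Option.elim, Pi.add_apply, Pi.smul_apply, smul_eq_mul,
    Finset.sum_apply, mul_add, Finset.sum_add_distrib, Finset.sum_const, nsmul_eq_mul]
  have : ∑ j ∈ J, θ * (Pi.single j lam : Strategy n) y = if y ∈ J then θ * lam else 0 := by
    simp [Pi.single_apply]
  rw [this]
  ring

/-- The thickened body is full-dimensional of the same shape. -/
lemma thicken_cornerBody (h : CornerBody lo lam R S) {τ : ℝ} (hτ : 0 < τ) (hτl : τ ≤ lam) :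
    CornerBody lo τ Finset.univ (thicken R lo τ S) := by
  have hcont : Continuous fun x : Strategy n => fun y => if y ∈ R then x y else lo y := by
    refine continuous_pi fun y => ?_
    by_cases hy : y ∈ R <;> simp [hy] <;> fun_prop
  have hlow : ∀ x ∈ thicken R lo τ S, lo ≤ x := fun x hx y => by
    by_cases hy : y ∈ R
    · simpa [hy] using h.lower _ hx.1 y
    · exact (hx.2 y hy).1
  refine ⟨hτ, ?_, ?_, hlow, ?_, ?_, ?_, ?_⟩
  · obtain ⟨b, hb⟩ := h.isCompact.isBounded.bddAbove
    have hclosed : IsClosed (thicken R lo τ S) := by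
      have : thicken R lo τ S = (fun x : Strategy n => fun y => if y ∈ R then x y else lo y) ⁻¹' S
          ∩ ⋂ y : Fin n, ⋂ _ : y ∉ R, (fun x : Strategy n => x y) ⁻¹' Icc (lo y) (lo y + τ) := by
        ext x; simp [thicken]
      rw [this]
      exact (h.isCompact.isClosed.preimage hcont).inter (isClosed_iInter fun y =>
        isClosed_iInter fun _ => isClosed_Icc.preimage (continuous_apply y))
    refine (isCompact_Icc (a := lo) (b := fun y => max (b y) (lo y + τ))).of_isClosed_subset hclosed
      fun x hx => ⟨hlow x hx, fun y => ?_⟩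
    by_cases hy : y ∈ R
    · exact le_max_of_le_left (by simpa [hy] using hb hx.1 y)
    · exact le_max_of_le_right (hx.2 y hy).2
  · intro x hx x' hx' a b ha hb hab
    refine ⟨?_, fun y hy => convex_Icc _ _ (hx.2 y hy) (hx'.2 y hy) ha hb hab⟩
    have := h.convex hx.1 hx'.1 ha hb hab
    convert this using 1
    funext y
    by_cases hy : y ∈ R
    · simp [hy]
    · simp [hy, ← add_mul, hab]
  · intro x hx x' hlx hxx
    refine ⟨h.downward _ hx.1 _ (fun y => ?_) fun y => ?_,
      fun y hy => ⟨hlx y, (hxx y).trans (hx.2 y hy).2⟩⟩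
    · by_cases hy : y ∈ R <;> simp [hy, hlx y]
    · by_cases hy : y ∈ R <;> simp [hy, hxx y]
  · simp
  · intro j _
    refine ⟨?_, fun y hy => ?_⟩
    · by_cases hj : j ∈ R
      · refine h.downward _ (h.slack j hj) _ (fun y => ?_) fun y => ?_
        · by_cases hyj : y = j
          · subst hyj; simp [hj, hτ.le]
          · by_cases hy : y ∈ R <;> simp [hy, hyj]
        · by_cases hyj : y = j
          · subst hyj; simp [hj, hτl]
          · by_cases hy : y ∈ R <;> simp [hy, hyj]
      · convert h.lo_mem using 1
        funext y
        by_cases hy : y ∈ R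
        · have : y ≠ j := fun e => hj (e ▸ hy)
          simp [hy, this]
        · simp [hy]
    · by_cases hyj : y = j
      · subst hyj; simp [hτ.le]
      · simp [hyj, hτ.le]
  · exact ⟨by simpa using h.lo_mem, fun y _ => by simp [hτ.le]⟩

lemma slack_mem_thicken (h : CornerBody lo lam R S) {τ : ℝ} (hτ : 0 ≤ τ) {j : Fin n}
    (hj : j ∈ R) : lo + Pi.single j lam ∈ thicken R lo τ S := by
  refine ⟨?_, fun y hy => ?_⟩
  · convert h.slack j hj using 1
    funext y
    by_cases hy : y ∈ R
    · simp [hy]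
    · have : y ≠ j := fun e => hy (e ▸ hj)
      simp [hy, this]
  · have : y ≠ j := fun e => hy (e ▸ hj)
    simp [this, hτ]

lemma nonneg_of_mem (h : CornerBody lo lam R S) (y : Fin n) :
    0 ≤ᵐ[volume.restrict S] fun x : Strategy n => x y - lo y := by
  filter_upwards [ae_restrict_mem h.isCompact.isClosed.measurableSet] with x hx
  exact sub_nonneg.2 (h.lower x hx y)

lemma integrableOn_coord (h : CornerBody lo lam R S) (y : Fin n) :
    IntegrableOn (fun x : Strategy n => x y - lo y) S :=
  ContinuousOn.integrableOn_compact h.isCompact (by fun_prop)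

lemma markov (h : CornerBody lo lam R S) (y : Fin n) (a : ℝ) :
    a * volume.real (S ∩ {x | a ≤ x y - lo y}) ≤ ∫ x in S, (x y - lo y) := by
  have := mul_meas_ge_le_integral_of_nonneg (h.nonneg_of_mem y) (h.integrableOn_coord y) a
  rwa [measureReal_restrict_apply' h.isCompact.isClosed.measurableSet, inter_comm] at this

/-- Sliding a slab of a downward closed body down keeps it inside the body. -/
lemma volume_slab_double (h : CornerBody lo lam R S) (y : Fin n) {a : ℝ} (ha : 0 ≤ a) :
    volume.real (S ∩ {x | x y - lo y < 2 * a}) ≤ 2 * volume.real (S ∩ {x | x y - lo y < a}) := by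
  have hfin : ∀ A : Set (Strategy n), volume (S ∩ A) ≠ ⊤ := fun A =>
    ((measure_mono inter_subset_left).trans_lt h.isCompact.measure_lt_top).ne
  have hsplit : S ∩ {x | x y - lo y < 2 * a} ⊆ (S ∩ {x | x y - lo y < a}) ∪
      (S ∩ {x | a ≤ x y - lo y ∧ x y - lo y < 2 * a}) := by
    rintro x ⟨hx, hx2⟩
    rcases lt_or_ge (x y - lo y) a with h1 | h1
    · exact Or.inl ⟨hx, h1⟩
    · exact Or.inr ⟨hx, h1, hx2⟩
  have hslide : volume.real (S ∩ {x | a ≤ x y - lo y ∧ x y - lo y < 2 * a})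
      ≤ volume.real (S ∩ {x | x y - lo y < a}) := by
    rw [measureReal_def, ← measure_preimage_add_right volume (Pi.single y a : Strategy n),
      ← measureReal_def]
    refine measureReal_mono ?_ (hfin _)
    rintro x ⟨hx, hx1, hx2⟩
    simp only [Pi.add_apply, Pi.single_eq_same] at hx1 hx2
    refine ⟨h.downward _ hx x (fun j => ?_) fun j => ?_, by
      change x y - lo y < a; linarith⟩
    · by_cases hj : j = y
      · subst hj; linarith
      · simpa [hj] using h.lower _ hx j
    · by_cases hj : j = y
      · subst hj; simp [ha]
      · simp [hj]
  calc volume.real (S ∩ {x | x y - lo y < 2 * a})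
      ≤ volume.real ((S ∩ {x | x y - lo y < a}) ∪
        (S ∩ {x | a ≤ x y - lo y ∧ x y - lo y < 2 * a})) :=
        measureReal_mono hsplit (by
          rw [← inter_union_distrib_left]; exact hfin _)
    _ ≤ _ := measureReal_union_le _ _
    _ ≤ _ := by linarith

/-- The part of a downward closed body above half of its mean height holds at most `7/8` of its
volume: by Markov's inequality half of the volume is below twice the mean height, and the lowest
of the four slabs there is the largest. -/
lemma volume_above_half_mean (h : CornerBody lo lam R S) (y : Fin n) {c : ℝ} (hc : 0 < c)
    (hmean : ∫ x in S, (x y - lo y) = volume.real S * c) :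
    volume.real (S ∩ {x | c / 2 ≤ x y - lo y}) ≤ 7 / 8 * volume.real S := by
  have hfin : volume S ≠ ⊤ := h.isCompact.measure_lt_top.ne
  have hsplit : ∀ a : ℝ, volume.real (S ∩ {x | x y - lo y < a}) +
      volume.real (S ∩ {x | a ≤ x y - lo y}) = volume.real S := fun a => by
    have hm : MeasurableSet {x : Strategy n | x y - lo y < a} :=
      measurableSet_lt (by fun_prop) measurable_const
    rw [← measureReal_inter_add_sdiff hm hfin]
    congr 2
    ext x
    simp
  have h1 := h.markov y (2 * c)
  have h2 := h.volume_slab_double y (a := c / 2) (by positivity)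
  have h3 := h.volume_slab_double y (a := c) hc.le
  rw [mul_div_cancel₀ c two_ne_zero] at h2
  have h4 := hsplit (2 * c)
  have h5 := hsplit (c / 2)
  have h6 : volume.real (S ∩ {x | 2 * c ≤ x y - lo y}) ≤ volume.real S / 2 := by
    rw [hmean] at h1
    nlinarith
  linarith

/-- A convex body with a point at height `a` has mean height at least `a / (4 n)`: shrinking it
towards that point by the factor `1 - 1 / (2 n)` keeps half of the volume. -/
lemma le_mean (h : CornerBody lo lam R S) {y : Fin n} {a : ℝ} (ha : 0 < a)
    (hp : lo + Pi.single y a ∈ S) :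
    volume.real S * (a / (4 * n)) ≤ ∫ x in S, (x y - lo y) := by
  have hn : (1 : ℝ) ≤ n := by
    have : 0 < n := (Nat.zero_le _).trans_lt y.2
    exact_mod_cast this
  set ρ : ℝ := 1 - 1 / (2 * n)
  have hρ2 : 1 / (2 * (n : ℝ)) ≤ 1 / 2 := by
    apply one_div_le_one_div_of_le <;> linarith
  have hρ : 0 ≤ ρ := by simp only [ρ]; linarith
  have hρ1 : 0 ≤ 1 / (2 * (n : ℝ)) := by positivity
  have hpow : 1 / 2 ≤ ρ ^ n := by
    have := one_add_mul_le_pow (a := -(1 / (2 * (n : ℝ)))) (by linarith) n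
    have h2 : 1 + (n : ℝ) * -(1 / (2 * n)) = 1 / 2 := by field_simp; norm_num
    rw [h2] at this
    simpa [ρ, sub_eq_add_neg] using this
  have hsub : AffineMap.homothety (lo + Pi.single y a) ρ '' S
      ⊆ S ∩ {x | a / (2 * n) ≤ x y - lo y} := by
    rintro _ ⟨x, hx, rfl⟩
    rw [AffineMap.homothety_apply, vsub_eq_sub, vadd_eq_add]
    refine ⟨?_, ?_⟩
    · have := h.convex hx hp hρ hρ1 (by simp [ρ])
      convert this using 1
      funext j
      simp [ρ]
      ring
    · have := h.lower x hx y
      simp only [mem_ofPred_eq, Pi.add_apply, Pi.smul_apply, Pi.sub_apply, smul_eq_mul,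
        Pi.single_eq_same]
      have h3 : ρ * (x y - (lo y + a)) + (lo y + a) - lo y
          = ρ * (x y - lo y) + a / (2 * n) := by
        simp only [ρ]; field_simp; ring
      rw [h3]
      have := mul_nonneg hρ (sub_nonneg.2 this)
      linarith
  have hvol : volume.real S / 2 ≤ volume.real (S ∩ {x | a / (2 * n) ≤ x y - lo y}) := by
    refine le_trans ?_ (measureReal_mono hsub
      ((measure_mono inter_subset_left).trans_lt h.isCompact.measure_lt_top).ne)
    rw [measureReal_def, measureReal_def, Measure.addHaar_image_homothety, ENNReal.toReal_mul,
      ENNReal.toReal_ofReal (abs_nonneg _), Module.finrank_fin_fun, abs_of_nonneg (by positivity)]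
    have : 0 ≤ (volume S).toReal := ENNReal.toReal_nonneg
    nlinarith
  have hm := h.markov y (a / (2 * n))
  have : 0 ≤ a / (2 * n) := by positivity
  calc volume.real S * (a / (4 * n)) = a / (2 * n) * (volume.real S / 2) := by
        field_simp; ring
    _ ≤ _ := (mul_le_mul_of_nonneg_left hvol this).trans hm

/-- The volume potential of a search region: the volume of the body thickened by `lam / (2 n)`. -/
noncomputable def regionVolume (R : Finset (Fin n)) (lo : Strategy n) (lam : ℝ)
    (S : Set (Strategy n)) : ℝ :=
  volume.real (thicken R lo (lam / (2 * n)) S)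

lemma thickness_pos (h : CornerBody lo lam R S) (hn : 1 ≤ n) : 0 < lam / (2 * n) := by
  have := h.lam_pos
  have : (1 : ℝ) ≤ n := by exact_mod_cast hn
  positivity

lemma thickness_le (h : CornerBody lo lam R S) (hn : 1 ≤ n) : lam / (2 * n) ≤ lam := by
  have hn : (1 : ℝ) ≤ n := by exact_mod_cast hn
  exact div_le_self h.lam_pos.le (by linarith)

lemma volume_Icc_add (lo : Strategy n) {D : ℝ} (hD : 0 ≤ D) :
    volume.real (Icc lo (fun y => lo y + D)) = D ^ n := by
  rw [measureReal_def, Real.volume_Icc_pi]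
  simp [ENNReal.toReal_ofReal hD]

lemma pow_le_regionVolume (h : CornerBody lo lam R S) (hn : 1 ≤ n) :
    (lam / (2 * n)) ^ n ≤ regionVolume R lo lam S := by
  have hτ := h.thickness_pos hn
  have hQ := h.thicken_cornerBody hτ (h.thickness_le hn)
  have hn' : (1 : ℝ) ≤ n := by exact_mod_cast hn
  have hR : (R.card : ℝ) ≤ n := by
    exact_mod_cast (Finset.card_le_univ R).trans_eq (Fintype.card_fin n)
  rw [← volume_Icc_add lo hτ.le]
  refine measureReal_mono (fun x hx => ⟨?_, fun y _ => ⟨hx.1 y, hx.2 y⟩⟩)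
    hQ.isCompact.measure_lt_top.ne
  refine h.mem_of_le (J := R) subset_rfl (θ := 1 / (2 * n)) (by positivity) ?_ h.lo_mem
    (fun y => ?_) fun y => ?_
  · rw [mul_one_div, div_le_one (by positivity)]
    linarith
  · by_cases hy : y ∈ R <;> simp [hy, hx.1 y]
  · have := hx.2 y
    by_cases hy : y ∈ R
    · simp only [hy, if_true, sub_self, mul_zero, add_zero]
      rw [one_div_mul_eq_div]
      exact this
    · simp [hy]

lemma regionVolume_le (h : CornerBody lo lam R S) (hn : 1 ≤ n) {D : ℝ}
    (hD : lam / (2 * n) ≤ D) (hS : ∀ x ∈ S, ∀ y, x y ≤ lo y + D) :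
    regionVolume R lo lam S ≤ D ^ n := by
  have hτ := h.thickness_pos hn
  have hQ := h.thicken_cornerBody hτ (h.thickness_le hn)
  rw [← volume_Icc_add lo (hτ.le.trans hD)]
  refine measureReal_mono (fun x hx => ⟨hQ.lower x hx, fun y => ?_⟩) isCompact_Icc.measure_lt_top.ne
  by_cases hy : y ∈ R
  · simpa [hy] using hS _ hx.1 y
  · exact (hx.2 y hy).2.trans (by simpa using hD)

lemma regionVolume_pos (h : CornerBody lo lam R S) (hn : 1 ≤ n) :
    0 < regionVolume R lo lam S :=
  (pow_pos (h.thickness_pos hn) n).trans_le (h.pow_le_regionVolume hn)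

lemma volume_face_pos (h : CornerBody lo lam R S) (hn : 1 ≤ n) :
    0 < volume.real (faceEmbed R lo ⁻¹' S) := by
  have h1 := h.regionVolume_pos hn
  have hτ := (h.thickness_pos hn).le
  rw [regionVolume, volume_thicken R lo S hτ] at h1
  exact pos_of_mul_pos_left h1 (by positivity)

lemma integrableOn_faceEmbed (h : CornerBody lo lam R S) :
    IntegrableOn (faceEmbed R lo) (faceEmbed R lo ⁻¹' S) :=
  (isometry_faceEmbed R lo).continuous.continuousOn.integrableOn_compact h.isCompact_preimage

lemma centroid_mem (h : CornerBody lo lam R S) (hn : 1 ≤ n) : centroid S ∈ S := by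
  rw [h.centroid_eq]
  refine h.convex.set_average_mem h.isCompact.isClosed ?_ h.isCompact_preimage.measure_lt_top.ne
    (ae_restrict_mem h.isCompact_preimage.isClosed.measurableSet) h.integrableOn_faceEmbed
  intro h0
  have := h.volume_face_pos hn
  rw [measureReal_def] at this
  rw [h0] at this
  simp at this

/-- In the free coordinates the centroid is the Lebesgue mean over the thickened body. -/
lemma integral_thicken_eq_centroid (h : CornerBody lo lam R S) (hn : 1 ≤ n) {y : Fin n}
    (hy : y ∈ R) :
    ∫ x in thicken R lo (lam / (2 * n)) S, (x y - lo y)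
      = regionVolume R lo lam S * (centroid S y - lo y) := by
  have hτ := h.thickness_pos hn
  have hQ := h.thicken_cornerBody hτ (h.thickness_le hn)
  have hint : IntegrableOn (fun x : Strategy n => x y) (thicken R lo (lam / (2 * n)) S) :=
    ContinuousOn.integrableOn_compact hQ.isCompact (by fun_prop)
  have hfin : volume (thicken R lo (lam / (2 * n)) S) < ⊤ := hQ.isCompact.measure_lt_top
  have hcoord : centroid S y = (volume.real (faceEmbed R lo ⁻¹' S))⁻¹ *
      ∫ z in faceEmbed R lo ⁻¹' S, z ⟨y, hy⟩ := by
    rw [h.centroid_eq, setAverage_eq, Pi.smul_apply, smul_eq_mul,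
      eval_integral fun i => h.integrableOn_faceEmbed.eval i]
    simp [faceEmbed, hy]
  have hpos := h.volume_face_pos hn
  rw [integral_sub hint (integrableOn_const hfin.ne), integral_thicken R lo S hτ.le ⟨y, hy⟩,
    setIntegral_const, hcoord, smul_eq_mul, regionVolume, volume_thicken R lo S hτ.le]
  field_simp

lemma le_centroid (h : CornerBody lo lam R S) {y : Fin n} (hy : y ∈ R) :
    lo y + lam / (4 * n) ≤ centroid S y := by
  have hn : 1 ≤ n := (Nat.zero_le _).trans_lt y.2
  have hτ := h.thickness_pos hn
  have hQ := h.thicken_cornerBody hτ (h.thickness_le hn)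
  have h1 := hQ.le_mean h.lam_pos (h.slack_mem_thicken hτ.le hy)
  rw [h.integral_thicken_eq_centroid hn hy] at h1
  have := le_of_mul_le_mul_left h1 (h.regionVolume_pos hn)
  linarith

/-- Cutting a search region not too far above its centroid leaves `7/8` of the volume. -/
lemma volume_cut_le (h : CornerBody lo lam R S) {y : Fin n} (hy : y ∈ R) {a : ℝ}
    (ha : (centroid S y + lo y) / 2 ≤ a) :
    volume.real (thicken R lo (lam / (2 * n)) S ∩ {x | a ≤ x y})
      ≤ 7 / 8 * regionVolume R lo lam S := by
  have hn : 1 ≤ n := (Nat.zero_le _).trans_lt y.2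
  have hτ := h.thickness_pos hn
  have hQ := h.thicken_cornerBody hτ (h.thickness_le hn)
  have hn' : (1 : ℝ) ≤ n := by exact_mod_cast hn
  have h4 : 0 < lam / (4 * n) := by have := h.lam_pos; positivity
  have h1 := hQ.volume_above_half_mean y (c := centroid S y - lo y)
    (by linarith [h.le_centroid hy]) (h.integral_thicken_eq_centroid hn hy)
  refine le_trans (measureReal_mono ?_
    ((measure_mono inter_subset_left).trans_lt hQ.isCompact.measure_lt_top).ne) h1
  intro x hx
  refine ⟨hx.1, ?_⟩
  have : a ≤ x y := hx.2
  change (centroid S y - lo y) / 2 ≤ x y - lo y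
  linarith

lemma exp_neg_le_pow {j n : ℕ} (hj : j ≤ n) (hn : 1 ≤ n) :
    Real.exp (-j) ≤ (1 - j * (1 / (2 * n)) : ℝ) ^ n := by
  have hn' : (1 : ℝ) ≤ n := by exact_mod_cast hn
  have hj' : (j : ℝ) ≤ n := by exact_mod_cast hj
  have hj0 : (0 : ℝ) ≤ j := by positivity
  have ht : (j : ℝ) * (1 / (2 * n)) ≤ 1 / 2 := by
    rw [mul_one_div, div_le_div_iff₀ (by positivity) (by norm_num)]
    linarith
  set t : ℝ := j * (1 / (2 * n)) with ht_def
  have ht0 : 0 ≤ t := by positivity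
  have hlog := Real.one_sub_inv_le_log_of_pos (x := 1 - t) (by linarith)
  have h2 : -(2 * t) ≤ 1 - (1 - t)⁻¹ := by
    have h3 : (1 - t)⁻¹ ≤ 1 + 2 * t := by
      rw [inv_le_iff_one_le_mul₀ (by linarith)]
      nlinarith
    linarith
  have h4 : (n : ℝ) * (2 * t) = j := by rw [ht_def]; field_simp
  calc Real.exp (-j) = Real.exp (n * (-(2 * t))) := by rw [mul_neg, h4]
    _ ≤ Real.exp (n * Real.log (1 - t)) :=
      Real.exp_le_exp.2 (mul_le_mul_of_nonneg_left (h2.trans hlog) (by positivity))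
    _ = (1 - t) ^ n := by rw [mul_comm, Real.exp_mul, Real.exp_log (by linarith), Real.rpow_natCast]

variable {lo' : Strategy n} {R' : Finset (Fin n)} {S' : Set (Strategy n)}

/-- Locking coordinates increases the volume of the thickened body by a factor of at most `e` per
coordinate: a copy of the new body scaled by `1 - j / (2 n)`, where `j` is the number of new locks,
fits into the old one, which has slack in those coordinates. -/
lemma regionVolume_lock_le (h : CornerBody lo lam R S) (h' : CornerBody lo' lam R' S')
    (hR : R' ⊆ R) (hS : S' ⊆ S) (hlo : lo ≤ lo') (hn : 1 ≤ n) :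
    regionVolume R' lo' lam S' ≤ Real.exp ((R \ R').card) * regionVolume R lo lam S := by
  have hτ := h.thickness_pos hn
  have hQ := h.thicken_cornerBody hτ (h.thickness_le hn)
  have hQ' := h'.thicken_cornerBody hτ (h'.thickness_le hn)
  have hn' : (1 : ℝ) ≤ n := by exact_mod_cast hn
  set j := (R \ R').card
  have hj : j ≤ n := (Finset.card_le_univ _).trans_eq (Fintype.card_fin n)
  have hj' : (j : ℝ) ≤ n := by exact_mod_cast hj
  set θ : ℝ := 1 / (2 * n)
  have hθ : 0 ≤ θ := by positivity
  have hjθ : j * θ ≤ 1 / 2 := by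
    simp only [θ]
    rw [mul_one_div, div_le_div_iff₀ (by positivity) (by norm_num)]
    linarith
  have hjθ0 : 0 ≤ j * θ := by positivity
  set ρ : ℝ := 1 - j * θ
  have hρ : 0 ≤ ρ := by simp only [ρ]; linarith
  have hρ1 : ρ ≤ 1 := by simp only [ρ]; linarith
  -- The corners of the two thickened bodies differ only by a translation in the locked coordinates.
  set w : Strategy n := fun y => lo y - ρ * (if y ∈ R' then lo y else lo' y) with hw
  have hsub : (fun x => x + w) '' (ρ • thicken R' lo' (lam / (2 * n)) S')
      ⊆ thicken R lo (lam / (2 * n)) S := by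
    rintro _ ⟨_, ⟨x, hx, rfl⟩, rfl⟩
    have hxlo' : lo' ≤ x := hQ'.lower x hx
    have hval : ∀ y, (ρ • x + w) y = lo y + ρ * (x y - if y ∈ R' then lo y else lo' y) := by
      intro y
      simp only [hw, Pi.add_apply, Pi.smul_apply, smul_eq_mul]
      ring
    have hge : ∀ y, lo y ≤ (ρ • x + w) y := by
      intro y
      rw [hval]
      have : 0 ≤ x y - if y ∈ R' then lo y else lo' y := by
        split_ifs
        · exact sub_nonneg.2 ((hlo y).trans (hxlo' y))
        · exact sub_nonneg.2 (hxlo' y)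
      linarith [mul_nonneg hρ this]
    have hle : ∀ y ∉ R', (ρ • x + w) y ≤ lo y + lam / (2 * n) := by
      intro y hy
      rw [hval, if_neg hy]
      have h1 : x y - lo' y ≤ lam / (2 * n) := by linarith [(hx.2 y hy).2]
      nlinarith [hxlo' y]
    refine ⟨?_, fun y hy => ⟨hge y, hle y fun hy' => hy (hR hy')⟩⟩
    have hb : (fun y => if y ∈ R' then x y else lo y) ∈ S := by
      refine h.downward _ (hS hx.1) _ (fun y => ?_) fun y => ?_
      · by_cases hy : y ∈ R'
        · simpa [hy] using (hlo y).trans (hxlo' y)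
        · simp [hy]
      · by_cases hy : y ∈ R'
        · simp [hy]
        · simpa [hy] using hlo y
    refine h.mem_of_le (J := R \ R') Finset.sdiff_subset hθ (by linarith) hb (fun y => ?_)
      fun y => ?_
    · by_cases hy : y ∈ R
      · simpa [hy] using hge y
      · simp [hy]
    · by_cases hy : y ∈ R
      · by_cases hy' : y ∈ R'
        · simp only [hy, hy', if_true, Finset.mem_sdiff, not_true_eq_false, and_false, if_false,
            add_zero]
          rw [hval, if_pos hy']
        · have := hle y hy'
          simp only [hy, hy', if_true, Finset.mem_sdiff, not_false_eq_true, and_true, if_false,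
            sub_self, mul_zero, add_zero]
          refine this.trans_eq ?_
          simp only [θ]; ring
      · have hy' : y ∉ R' := fun h => hy (hR h)
        simp [hy, hy']
  have hvol := measureReal_mono (μ := volume) hsub hQ.isCompact.measure_lt_top.ne
  rw [measureReal_def, image_add_right, measure_preimage_add_right, Measure.addHaar_smul,
    ENNReal.toReal_mul, ENNReal.toReal_ofReal (abs_nonneg _), Module.finrank_fin_fun,
    abs_of_nonneg (by positivity)] at hvol
  have hexp := exp_neg_le_pow hj hn
  change ρ ^ n * regionVolume R' lo' lam S' ≤ regionVolume R lo lam S at hvol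
  have h1 := (mul_le_mul_of_nonneg_right hexp (h'.regionVolume_pos hn).le).trans hvol
  calc regionVolume R' lo' lam S'
      = Real.exp j * (Real.exp (-j) * regionVolume R' lo' lam S') := by
        rw [← mul_assoc, ← Real.exp_add]; simp
    _ ≤ _ := mul_le_mul_of_nonneg_left h1 (Real.exp_pos _).le

/-- The potential of a search region: its volume, with a factor `e ^ 2` for each free
coordinate that pays for locking that coordinate later. -/
noncomputable def potential (R : Finset (Fin n)) (lo : Strategy n) (lam : ℝ)
    (S : Set (Strategy n)) : ℝ :=
  regionVolume R lo lam S * Real.exp (2 * R.card)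

/-- Every response in the main loop shrinks the potential by a constant factor. -/
lemma potential_le (h : CornerBody lo lam R S) (h' : CornerBody lo' lam R' S')
    (hR : R' ⊆ R) (hS : S' ⊆ S) (hlo : lo ≤ lo') {z : Fin n} (hz : z ∈ R)
    (hlo_eq : ∀ y ≠ z, lo' y = lo y) (hcut : (centroid S z + lo z) / 2 ≤ lo' z) :
    potential R' lo' lam S' ≤ 7 / 8 * potential R lo lam S := by
  have hn : 1 ≤ n := (Nat.zero_le _).trans_lt z.2
  have hτ := h.thickness_pos hn
  have hQ := h.thicken_cornerBody hτ (h.thickness_le hn)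
  -- Without a new lock the cut removes volume; otherwise the locks pay, and the cut is not used.
  rcases hR.eq_or_ssubset with rfl | hss
  · have hsub : thicken R' lo' (lam / (2 * n)) S'
        ⊆ thicken R' lo (lam / (2 * n)) S ∩ {x | lo' z ≤ x z} := by
      rintro x hx
      have heq : ∀ y ∉ R', lo' y = lo y := fun y hy => hlo_eq y fun e => hy (e ▸ hz)
      refine ⟨⟨?_, fun y hy => heq y hy ▸ hx.2 y hy⟩, ?_⟩
      · convert hS hx.1 using 1
        funext y
        by_cases hy : y ∈ R' <;> simp [hy, heq]
      · have := h'.lower _ hx.1 z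
        simpa [hz] using this
    have h1 := (measureReal_mono hsub
      ((measure_mono inter_subset_left).trans_lt hQ.isCompact.measure_lt_top).ne).trans
      (h.volume_cut_le hz hcut)
    rw [potential, potential, ← mul_assoc]
    exact mul_le_mul_of_nonneg_right h1 (Real.exp_pos _).le
  · have h1 := h.regionVolume_lock_le h' hR hS hlo hn
    have hcard : ((R \ R').card : ℝ) = R.card - R'.card := by
      rw [Finset.card_sdiff_of_subset hR, Nat.cast_sub (Finset.card_le_card hR)]
    have hlt : (R'.card : ℝ) + 1 ≤ R.card := by exact_mod_cast Finset.card_lt_card hss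
    have hpos := h.regionVolume_pos hn
    calc potential R' lo' lam S'
        ≤ Real.exp ((R \ R').card) * regionVolume R lo lam S * Real.exp (2 * R'.card) :=
          mul_le_mul_of_nonneg_right h1 (Real.exp_pos _).le
      _ = Real.exp (-(R.card - R'.card)) * potential R lo lam S := by
          rw [potential, hcard, mul_comm (Real.exp _) (regionVolume _ _ _ _), mul_assoc,
            ← Real.exp_add, mul_left_comm, ← Real.exp_add]
          congr 2
          ring
      _ ≤ Real.exp (-1) * potential R lo lam S := by
          refine mul_le_mul_of_nonneg_right (Real.exp_le_exp.2 (by linarith)) ?_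
          exact mul_nonneg hpos.le (Real.exp_pos _).le
      _ ≤ _ := by
          refine mul_le_mul_of_nonneg_right ?_ (mul_nonneg hpos.le (Real.exp_pos _).le)
          have : Real.exp (-1) < 0.3678794412 := Real.exp_neg_one_lt_d9
          linarith

end CornerBody

/-! ### The conservative strategy -/

section

variable {X : Set (Strategy n)} {u v : Fin n → ℝ → ℝ} {C W : ℝ}

lemma IsSecurityGame.isCompact (G : IsSecurityGame X u v) : IsCompact X :=
  (isCompact_Icc (a := (0 : Strategy n)) (b := 1)).of_isClosed_subset G.isClosed
    fun x hx => ⟨fun y => (G.mem_cube x hx y).1, fun y => (G.mem_cube x hx y).2⟩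

namespace IsRegular

lemma pos (hR : IsRegular X u v C W) : 0 < C := zero_lt_one.trans_le hR.one_le

lemma v_lower (hR : IsRegular X u v C W) (y : Fin n) {s t : ℝ} (hs : 0 ≤ s) (hst : s ≤ t)
    (ht : t ≤ 1) : (t - s) / C ≤ v y s - v y t := by
  rcases hst.eq_or_lt with rfl | h
  · simp
  · have := (hR.v_slope y s t hs h ht).1
    rw [le_div_iff₀ (sub_pos.2 h)] at this
    rwa [div_eq_mul_one_div, mul_comm]

lemma v_upper (hR : IsRegular X u v C W) (y : Fin n) {s t : ℝ} (hs : 0 ≤ s) (hst : s ≤ t)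
    (ht : t ≤ 1) : v y s - v y t ≤ C * (t - s) := by
  rcases hst.eq_or_lt with rfl | h
  · simp
  · have := (hR.v_slope y s t hs h ht).2
    rwa [div_le_iff₀ (sub_pos.2 h)] at this

lemma v_anti (hR : IsRegular X u v C W) (y : Fin n) {s t : ℝ} (hs : 0 ≤ s) (hst : s ≤ t)
    (ht : t ≤ 1) : v y t ≤ v y s := by
  have h1 := hR.v_lower y hs hst ht
  have h2 : 0 ≤ (t - s) / C := div_nonneg (by linarith) hR.pos.le
  linarith

lemma u_upper (hR : IsRegular X u v C W) (y : Fin n) {s t : ℝ} (hs : 0 ≤ s) (hst : s ≤ t)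
    (ht : t ≤ 1) : u y t - u y s ≤ C * (t - s) := by
  rcases hst.eq_or_lt with rfl | h
  · simp
  · have := (hR.u_slope y s t hs h ht).2
    rwa [div_le_iff₀ (sub_pos.2 h)] at this

lemma u_mono (hR : IsRegular X u v C W) (y : Fin n) {s t : ℝ} (hs : 0 ≤ s) (hst : s ≤ t)
    (ht : t ≤ 1) : u y s ≤ u y t := by
  rcases hst.eq_or_lt with rfl | h
  · simp
  · have := (hR.u_slope y s t hs h ht).1
    rw [lt_div_iff₀ (sub_pos.2 h)] at this
    linarith

end IsRegular

/-- `xs` minimises the agent's best-response payoff over `X`, the minimum being `Vs`, and defends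
no target more than needed: a target that is not a best response is not defended at all. -/
structure IsConservative (X : Set (Strategy n)) (v : Fin n → ℝ → ℝ) (W : ℝ) (xs : Strategy n)
    (Vs : ℝ) : Prop where
  mem : xs ∈ X
  le_val : ∀ y, v y (xs y) ≤ Vs
  tight_or_zero : ∀ y, (v y (xs y) = Vs ∧ W ≤ xs y) ∨ (v y (xs y) < Vs ∧ xs y = 0)
  val_le : ∀ x ∈ X, ∃ y, Vs ≤ v y (x y)

lemma exists_bestResponse [Nonempty (Fin n)] (v : Fin n → ℝ → ℝ) (x : Strategy n) :
    ∃ y, y ∈ bestResponses v x := by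
  obtain ⟨y, hy⟩ := Finite.exists_max fun y => payoff v x y
  exact ⟨y, hy⟩

lemma exists_conservative [Nonempty (Fin n)] (G : IsSecurityGame X u v)
    (hR : IsRegular X u v C W) : ∃ xs Vs, IsConservative X v W xs Vs := by
  have hcont : ContinuousOn
      (fun x : Strategy n => Finset.univ.sup' Finset.univ_nonempty fun y => v y (x y)) X := by
    refine ContinuousOn.finset_sup'_apply _ fun y _ => ?_
    exact (G.v_continuousOn y).comp (continuous_apply y).continuousOn
      fun x hx => G.mem_cube x hx y
  obtain ⟨x₀, hx₀, hmin⟩ := G.isCompact.exists_isMinOn G.nonempty hcont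
  set Vs := Finset.univ.sup' Finset.univ_nonempty fun y => v y (x₀ y) with hVs
  have hval : ∀ x ∈ X, ∃ y, Vs ≤ v y (x y) := by
    intro x hx
    obtain ⟨y, -, hy⟩ := Finset.exists_mem_eq_sup' Finset.univ_nonempty fun y => v y (x y)
    exact ⟨y, (hmin hx).trans_eq hy⟩
  have hle₀ : ∀ y, v y (x₀ y) ≤ Vs := fun y =>
    Finset.le_sup' (fun y => v y (x₀ y)) (Finset.mem_univ y)
  have hex : ∀ y, ∃ s ∈ Icc 0 (x₀ y), v y s = Vs ∨ (v y s < Vs ∧ s = 0) := by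
    intro y
    have h0 := G.mem_cube x₀ hx₀ y
    rcases lt_or_ge (v y 0) Vs with h | h
    · exact ⟨0, ⟨le_rfl, h0.1⟩, Or.inr ⟨h, rfl⟩⟩
    · obtain ⟨s, hs, hs'⟩ := intermediate_value_Icc' h0.1
        ((G.v_continuousOn y).mono (Icc_subset_Icc_right h0.2)) ⟨hle₀ y, h⟩
      exact ⟨s, hs, Or.inl hs'⟩
  choose xs hxs hxs' using hex
  have hmem : xs ∈ X := G.downward x₀ hx₀ xs (fun y => (hxs y).1) fun y => (hxs y).2
  have hle : ∀ y, v y (xs y) ≤ Vs := fun y => (hxs' y).elim (fun h => h.le) fun h => h.1.le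
  refine ⟨xs, Vs, hmem, hle, fun y => (hxs' y).imp_left fun h => ⟨h, ?_⟩, hval⟩
  obtain ⟨a, ha, b, hb, hab⟩ := hR.width y ⟨xs, hmem, fun y' => (hle y').trans_eq h.symm⟩
  obtain ⟨y', hy'⟩ := hval a ha.1
  have h1 : Vs ≤ v y (a y) := hy'.trans (ha.2 y')
  have hb0 := (G.mem_cube b hb.1 y).1
  have h2 : a y ≤ xs y := by
    by_contra! hlt
    have := G.v_strictAntiOn y (G.mem_cube xs hmem y) (G.mem_cube a ha.1 y) hlt
    linarith
  linarith

variable {xs : Strategy n} {Vs : ℝ}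

/-- An approximate best response is hardly overdefended. -/
lemma IsConservative.sub_le (hc : IsConservative X v W xs Vs) (G : IsSecurityGame X u v)
    (hR : IsRegular X u v C W) {x : Strategy n} (hx : x ∈ X) {y : Fin n} {ε : ℝ} (hε : 0 ≤ ε)
    (hy : ∀ y', payoff v x y' ≤ payoff v x y + ε) : x y - C * ε ≤ xs y := by
  have hC := hR.pos
  rcases le_or_gt (x y) (xs y) with h | h
  · nlinarith
  · obtain ⟨y', hy'⟩ := hc.val_le x hx
    have h1 := hR.v_lower y (G.mem_cube xs hc.mem y).1 h.le (G.mem_cube x hx y).2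
    have h2 := hc.le_val y
    have h3 : Vs ≤ v y (x y) + ε := hy'.trans (hy y')
    have h4 : (x y - xs y) / C ≤ ε := by linarith
    rw [div_le_iff₀ hC] at h4
    linarith

/-- If a hardly underdefended target is an approximate best response, the agent's payoff is
almost minimal. -/
lemma IsConservative.payoff_le (hc : IsConservative X v W xs Vs) (G : IsSecurityGame X u v)
    (hR : IsRegular X u v C W) {x : Strategy n} (hx : x ∈ X) {y : Fin n} {ε lam : ℝ}
    (hlam : 0 ≤ lam) (hxy : xs y ≤ x y + lam)
    (hy : ∀ y', payoff v x y' ≤ payoff v x y + ε) (y' : Fin n) :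
    v y' (x y') ≤ Vs + (C * lam + ε) := by
  have hC := hR.pos
  have h1 : v y (x y) ≤ Vs + C * lam := by
    rcases le_or_gt (xs y) (x y) with h | h
    · have := hR.v_anti y (G.mem_cube xs hc.mem y).1 h (G.mem_cube x hx y).2
      have := hc.le_val y
      nlinarith
    · have := hR.v_upper y (G.mem_cube x hx y).1 h.le (G.mem_cube xs hc.mem y).2
      have := hc.le_val y
      nlinarith
  have h2 : v y' (x y') ≤ v y (x y) + ε := hy y'
  linarith

lemma IsConservative.le_add (hc : IsConservative X v W xs Vs) (G : IsSecurityGame X u v)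
    (hR : IsRegular X u v C W) {y : Fin n} {β s : ℝ} (hs : 0 ≤ s) (hβ : 0 ≤ β)
    (hy : v y s ≤ Vs + β) : xs y ≤ s + C * β := by
  have hC := hR.pos
  rcases le_or_gt (xs y) s with h | h
  · nlinarith
  · rcases hc.tight_or_zero y with ⟨h1, -⟩ | ⟨-, h1⟩
    · have h2 := hR.v_lower y hs h.le (G.mem_cube xs hc.mem y).2
      have h3 : (xs y - s) / C ≤ β := by linarith
      rw [div_le_iff₀ hC] at h3
      linarith
    · linarith

/-- The principal gains no more from any commitment than from the conservative strategy. -/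
lemma IsConservative.stageValue_le [Nonempty (Fin n)] (hc : IsConservative X v W xs Vs)
    (G : IsSecurityGame X u v) (hR : IsRegular X u v C W) {x : Strategy n} (hx : x ∈ X) :
    ∃ y, W ≤ xs y ∧ v y (xs y) = Vs ∧ stageValue u v x ≤ u y (xs y) := by
  obtain ⟨y₀, hy₀⟩ := exists_bestResponse v x
  obtain ⟨y, hy, hyv⟩ := (Set.Nonempty.image (payoff u x) ⟨y₀, hy₀⟩).csSup_mem
    ((bestResponses v x).toFinite.image _)
  obtain ⟨y', hy'⟩ := hc.val_le x hx
  have h1 : Vs ≤ v y (x y) := hy'.trans (hy y')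
  have hxy := G.mem_cube x hx y
  have hsy := G.mem_cube xs hc.mem y
  rcases hc.tight_or_zero y with ⟨h2, h3⟩ | ⟨h2, h3⟩
  · refine ⟨y, h3, h2, ?_⟩
    rw [stageValue, ← hyv]
    have h4 : x y ≤ xs y := by
      by_contra! hlt
      have := G.v_strictAntiOn y hsy hxy hlt
      linarith
    exact hR.u_mono y hxy.1 h4 hsy.2
  · have h4 := hR.v_anti y le_rfl hxy.1 hxy.2
    rw [h3] at h2
    linarith

lemma stageValue_le_one [Nonempty (Fin n)] (G : IsSecurityGame X u v) {x : Strategy n}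
    (hx : x ∈ X) : stageValue u v x ≤ 1 := by
  obtain ⟨y₀, hy₀⟩ := exists_bestResponse v x
  refine csSup_le (Set.Nonempty.image (payoff u x) ⟨y₀, hy₀⟩) ?_
  rintro _ ⟨y, -, rfl⟩
  exact (G.u_mapsTo y (G.mem_cube x hx y)).2

/-! ### Exploitation -/

lemma perturb_mem (G : IsSecurityGame X u v) (hW : 0 < W) {xhat : Strategy n} (hx : xhat ∈ X)
    {lam : ℝ} (hlam : 0 ≤ lam) (hlam1 : lam ≤ 1) : perturb u W xhat lam ∈ X := by
  unfold perturb
  split_ifs with h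
  · have h1 := h.choose_spec.1
    refine G.downward xhat hx _ (fun j => ?_) fun j => ?_
    · by_cases hj : j = h.choose
      · rw [hj]
        simp only [Pi.zero_apply, Pi.sub_apply, Pi.single_eq_same]
        nlinarith
      · simp [hj, (G.mem_cube xhat hx j).1]
    · by_cases hj : j = h.choose
      · rw [hj]
        simp only [Pi.sub_apply, Pi.single_eq_same]
        nlinarith
      · simp [hj]
  · exact hx

/-- Near the conservative strategy, lowering the defence of the best target makes it the unique
best response, so that the agent's behaviour costs the principal little. -/
lemma IsConservative.perturb_regret [Nonempty (Fin n)] (hc : IsConservative X v W xs Vs)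
    (G : IsSecurityGame X u v) (hR : IsRegular X u v C W) {xhat : Strategy n} (hx : xhat ∈ X)
    {lam : ℝ} (hlam : 0 < lam) (hlam1 : lam ≤ 1)
    (hclose : ∀ y, |xhat y - xs y| ≤ W * lam / (6 * C ^ 2)) {y : Fin n}
    (hy : y ∈ bestResponses v (perturb u W xhat lam)) {x : Strategy n} (hxX : x ∈ X) :
    stageValue u v x - payoff u (perturb u W xhat lam) y ≤ C * W * lam := by
  have hC := hR.pos
  have hC1 := hR.one_le
  have hW := hR.width_pos
  have hmem := perturb_mem G hW hx hlam.le hlam1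
  set δ := W * lam / (6 * C ^ 2) with hδ
  have hWl : 0 < W * lam := mul_pos hW hlam
  have hδC : δ * C ^ 2 = W * lam / 6 := by rw [hδ]; field_simp
  have hδ0 : 0 < δ := by positivity
  have hCsq : 1 ≤ C ^ 2 := one_le_pow₀ hC1
  have hδ1 : δ ≤ W * lam / 6 := by nlinarith
  have hδW : δ ≤ W / 6 := by nlinarith
  obtain ⟨y₁, hy₁W, hy₁V, hy₁⟩ := hc.stageValue_le G hR hxX
  have habs := fun y => abs_le.1 (hclose y)
  have hy₁hat : W / 2 < xhat y₁ := by linarith [(habs y₁).1]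
  have hex : ∃ y, W / 2 < xhat y ∧ ∀ y', W / 2 < xhat y' → payoff u xhat y' ≤ payoff u xhat y := by
    obtain ⟨y, hy, hmax⟩ := (Finset.univ.filter fun y => W / 2 < xhat y).exists_max_image
      (fun y => payoff u xhat y) ⟨y₁, by simp [hy₁hat]⟩
    exact ⟨y, by simpa using hy, fun y' hy' => hmax y' (by simp [hy'])⟩
  have hp : perturb u W xhat lam = xhat - Pi.single hex.choose (W * lam / 2) := by
    unfold perturb
    rw [dif_pos hex]
  obtain ⟨h1, h2⟩ := hex.choose_spec
  set z := hex.choose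
  rw [hp] at hy hmem ⊢
  have hzval : (xhat - Pi.single z (W * lam / 2) : Strategy n) z = xhat z - W * lam / 2 := by simp
  have hz0 := G.mem_cube _ hmem z
  rw [hzval] at hz0
  have hhat := fun y => G.mem_cube xhat hx y
  have hsc := fun y => G.mem_cube xs hc.mem y
  have hztight : v z (xs z) = Vs := by
    rcases hc.tight_or_zero z with h | h
    · exact h.1
    · linarith [(habs z).2, h.2]
  -- The other targets are worth at most `Vs + C δ` to the agent, and the perturbed one is worth more.
  have hyz : y = z := by
    by_contra hne
    have h3 := hy z
    unfold payoff at h3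
    rw [hzval] at h3
    have hyval : (xhat - Pi.single z (W * lam / 2) : Strategy n) y = xhat y := by simp [hne]
    rw [hyval] at h3
    have h4 := hR.v_lower z hz0.1 (show xhat z - W * lam / 2 ≤ xs z by linarith [(habs z).2])
      (hsc z).2
    have h5 : v y (xhat y) ≤ Vs + C * δ := by
      rcases le_or_gt (xs y) (xhat y) with h | h
      · have := hR.v_anti y (hsc y).1 h (hhat y).2
        have := hc.le_val y
        nlinarith
      · have h6 := hR.v_upper y (hhat y).1 h.le (hsc y).2
        have := hc.le_val y
        have : C * (xs y - xhat y) ≤ C * δ :=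
          mul_le_mul_of_nonneg_left (by linarith [(habs y).1]) hC.le
        linarith
    have h6 : (xs z - (xhat z - W * lam / 2)) / C ≤ C * δ := by linarith
    rw [div_le_iff₀ hC] at h6
    have h7 : C * δ * C = W * lam / 6 := by rw [← hδC]; ring
    linarith [(habs z).2]
  subst hyz
  have h3 : payoff u xhat y₁ ≤ payoff u xhat z := h2 y₁ hy₁hat
  unfold payoff at h3 ⊢
  rw [hzval]
  have h4 : u y₁ (xs y₁) ≤ u y₁ (xhat y₁) + C * δ := by
    rcases le_or_gt (xs y₁) (xhat y₁) with h | h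
    · have := hR.u_mono y₁ (hsc y₁).1 h (hhat y₁).2
      nlinarith
    · have h6 := hR.u_upper y₁ (hhat y₁).1 h.le (hsc y₁).2
      have : C * (xs y₁ - xhat y₁) ≤ C * δ :=
        mul_le_mul_of_nonneg_left (by linarith [(habs y₁).1]) hC.le
      linarith
  have h5 := hR.u_upper z hz0.1 (show xhat z - W * lam / 2 ≤ xhat z by linarith) (hhat z).2
  have h6 : C * (xhat z - (xhat z - W * lam / 2)) = C * (W * lam) / 2 := by ring
  have h7 : C * δ ≤ C * (W * lam / 6) := mul_le_mul_of_nonneg_left hδ1 hC.le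
  have h8 : 0 ≤ C * (W * lam) := by positivity
  nlinarith

end

/-! ### Clinch plays feasible strategies -/

/-- The search region of Clinch with its bounds and its set `R` of active targets. -/
structure SearchRegion (X : Set (Strategy n)) (lam : ℝ) (lo hi : Strategy n)
    (R : Finset (Fin n)) (S : Set (Strategy n)) : Prop where
  eq : S = {x' | x' ∈ X ∧ lo ≤ x' ∧ x' ≤ hi}
  lo_nonneg : 0 ≤ lo
  lo_mem : lo ∈ S
  locked : ∀ y ∉ R, hi y = lo y
  slack : ∀ y ∈ R, lo + Pi.single y lam ∈ S

/-- Structural invariant of Clinch, valid for arbitrary responses. -/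
def ClinchState.Feasible (X : Set (Strategy n)) (lam : ℝ) : ClinchState n → Prop
  | .minimize lo hi R S => SearchRegion X lam lo hi R S
  | .conserve x lo xhat y _ l r =>
      x ∈ X ∧ 0 ≤ lo ∧ lo ≤ x ∧ 0 ≤ xhat ∧ xhat ≤ x ∧ lo y ≤ l ∧ l ≤ r ∧ r ≤ x y
  | .done xhat => xhat ∈ X

section

variable {X : Set (Strategy n)} {u v : Fin n → ℝ → ℝ} {C W : ℝ}

lemma SearchRegion.cornerBody {lam : ℝ} {lo hi : Strategy n} {R : Finset (Fin n)}
    {S : Set (Strategy n)} (h : SearchRegion X lam lo hi R S) (G : IsSecurityGame X u v)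
    (hlam : 0 < lam) : CornerBody lo lam R S := by
  have hS : S = X ∩ Icc lo hi := h.eq
  refine ⟨hlam, ?_, ?_, ?_, ?_, ?_, h.slack, h.lo_mem⟩
  · rw [hS]; exact G.isCompact.inter_right isClosed_Icc
  · rw [hS]; exact G.convex.inter (convex_Icc _ _)
  · intro x hx; rw [hS] at hx; exact hx.2.1
  · intro x hx x' h1 h2
    rw [hS] at hx ⊢
    exact ⟨G.downward x hx.1 x' (h.lo_nonneg.trans h1) h2, h1, h2.trans hx.2.2⟩
  · intro x hx y hy
    rw [hS] at hx
    exact le_antisymm ((hx.2.2 y).trans_eq (h.locked y hy)) (hx.2.1 y)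

/-- What the top of the main loop does to the bounds: `S` is the previous region, which decides
about the locks. -/
lemma minimizeLoop_spec {lam : ℝ} (hlam : 0 < lam) {lo hi : Strategy n} {R : Finset (Fin n)}
    {S : Set (Strategy n)} (hlo0 : 0 ≤ lo) (hloX : lo ∈ X) (hlohi : lo ≤ hi)
    (hin : ∀ y, lo + Pi.single y lam ∈ S → lo + Pi.single y lam ∈ X ∧ lo y + lam ≤ hi y)
    (hout : ∀ y ∉ R, lo + Pi.single y lam ∉ S) :
    ∃ hi' R' S', minimizeLoop X lam lo hi R S = .minimize lo hi' R' S' ∧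
      SearchRegion X lam lo hi' R' S' ∧ R' ⊆ R ∧ hi' ≤ hi ∧ (∀ y ∈ R', hi' y = hi y) ∧
      ∀ y ∉ R', lo + Pi.single y lam ∉ S := by
  classical
  have hR' : ∀ y, y ∈ R \ Finset.univ.filter (fun y => lo + Pi.single y lam ∉ S) ↔
      lo + Pi.single y lam ∈ S := by
    intro y
    simp only [Finset.mem_sdiff, Finset.mem_filter, Finset.mem_univ, true_and, not_not]
    exact ⟨fun h => h.2, fun h => ⟨by_contra fun hy => hout y hy h, h⟩⟩
  have hlohi' : lo ≤ fun y =>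
      if y ∈ Finset.univ.filter (fun y => lo + Pi.single y lam ∉ S) then lo y else hi y := by
    intro y
    dsimp only
    split_ifs
    exacts [le_rfl, hlohi y]
  refine ⟨_, _, _, rfl, ⟨rfl, hlo0, ⟨hloX, le_rfl, hlohi'⟩, ?_, ?_⟩,
    Finset.sdiff_subset, ?_, ?_, ?_⟩
  · intro y hy
    rw [hR'] at hy
    simp [hy]
  · intro y hy
    rw [hR'] at hy
    refine ⟨(hin y hy).1, fun j => ?_, fun j => ?_⟩
    · by_cases hj : j = y
      · subst hj; simp [hlam.le]
      · simp [hj]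
    · by_cases hj : j = y
      · subst hj; simpa [hy] using (hin j hy).2
      · simpa [hj] using hlohi' j
  · intro y
    dsimp only
    split_ifs
    exacts [hlohi y, le_rfl]
  · intro y hy
    rw [hR'] at hy
    simp [hy]
  · intro y hy
    rwa [hR'] at hy

lemma conserveLoop_feasible (G : IsSecurityGame X u v) {lam : ℝ}
    {x lo : Strategy n} (hx : x ∈ X) (hlo0 : 0 ≤ lo) (hlox : lo ≤ x) (ys : List (Fin n))
    {xhat : Strategy n} (h0 : 0 ≤ xhat) (hle : xhat ≤ x) :
    (conserveLoop lam x lo xhat ys).Feasible X lam := by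
  induction ys generalizing xhat with
  | nil => exact G.downward x hx xhat h0 hle
  | cons y ys ih =>
    unfold conserveLoop
    split_ifs
    · exact ⟨hx, hlo0, hlox, h0, hle, le_rfl, hlox y, le_rfl⟩
    · refine ih (fun j => ?_) fun j => ?_
      · by_cases hj : j = y
        · subst hj; simpa using hlo0 j
        · simpa [hj] using h0 j
      · by_cases hj : j = y
        · subst hj; simpa using hlox j
        · simpa [hj] using hle j

lemma clinchInit_spec {δ : ℝ} (hlam : 0 < clinchTol C δ) {lo hi : Strategy n} (hlo0 : 0 ≤ lo)
    (hloX : lo ∈ X) (hlohi : ∀ y, lo y + clinchTol C δ ≤ hi y) :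
    ∃ hi' R' S', clinchInit X C δ lo hi = .minimize lo hi' R' S' ∧
      SearchRegion X (clinchTol C δ) lo hi' R' S' ∧ hi' ≤ hi ∧ (∀ y ∈ R', hi' y = hi y) ∧
      ∀ y ∉ R', lo + Pi.single y (clinchTol C δ) ∉ X := by
  obtain ⟨hi', R', S', h1, h2, -, h3, h4, h5⟩ := minimizeLoop_spec (R := Finset.univ) (S := X)
    hlam hlo0 hloX (fun y => by linarith [hlohi y]) (fun y hy => ⟨hy, hlohi y⟩) (by simp)
  exact ⟨hi', R', S', h1, h2, h3, h4, h5⟩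

lemma update_mem (G : IsSecurityGame X u v) {x : Strategy n} (hx : x ∈ X) {y : Fin n} {m : ℝ}
    (h0 : 0 ≤ m) (hm : m ≤ x y) : Function.update x y m ∈ X := by
  refine G.downward x hx _ (fun j => ?_) fun j => ?_
  · by_cases hj : j = y
    · subst hj; simpa using h0
    · simpa [hj] using (G.mem_cube x hx j).1
  · by_cases hj : j = y
    · subst hj; simpa using hm
    · simp [hj]

lemma clinchQuery_mem (G : IsSecurityGame X u v) (hn : 1 ≤ n) {lam : ℝ} (hlam : 0 < lam)
    {s : ClinchState n} (hs : s.Feasible X lam) : clinchQuery s ∈ X := by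
  cases s with
  | minimize lo hi R S =>
    have h1 := (SearchRegion.cornerBody hs G hlam).centroid_mem hn
    rw [SearchRegion.eq hs] at h1
    simpa [clinchQuery, ← SearchRegion.eq hs] using h1.1
  | conserve x lo xhat y ys l r =>
    obtain ⟨hx, hlo0, hlox, h0, hle, hl, hlr, hr⟩ := hs
    have : 0 ≤ lo y := hlo0 y
    exact update_mem G hx (by linarith) (by linarith)
  | done xhat => exact hs

lemma clinchTol_pos (hC : 0 < C) {δ : ℝ} (hδ : 0 < δ) : 0 < clinchTol C δ := by
  unfold clinchTol; positivity

lemma clinchEps_nonneg (hC : 0 < C) {δ : ℝ} (hδ : 0 < δ) : 0 ≤ clinchEps n C δ := by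
  unfold clinchEps; positivity

/-- The lower bounds after a response to the centroid query. -/
lemma lower_update_spec {x lo : Strategy n} (hlox : lo ≤ x) (z : Fin n) {ε : ℝ} (hε : 0 ≤ ε) :
    lo ≤ Function.update lo z (max (lo z) (x z - ε)) ∧
      Function.update lo z (max (lo z) (x z - ε)) ≤ x := by
  constructor
  · intro j
    by_cases hj : j = z
    · subst hj; simp
    · simp [hj]
  · intro j
    by_cases hj : j = z
    · subst hj; simpa [hε] using hlox j
    · simpa [hj] using hlox j

/-- A response to an active target in the main loop yields another search region. -/
lemma SearchRegion.respond {δ : ℝ} {lo hi : Strategy n} {R : Finset (Fin n)}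
    {S : Set (Strategy n)} (h : SearchRegion X (clinchTol C δ) lo hi R S)
    (G : IsSecurityGame X u v) (hC : 0 < C) (hδ : 0 < δ) {z : Fin n} (hz : z ∈ R) :
    ∃ hi' R' S', clinchRespond X C δ (.minimize lo hi R S) z
        = .minimize (Function.update lo z (max (lo z) (centroid S z - C * clinchEps n C δ)))
          hi' R' S' ∧
      SearchRegion X (clinchTol C δ)
        (Function.update lo z (max (lo z) (centroid S z - C * clinchEps n C δ))) hi' R' S' ∧
      R' ⊆ R ∧ hi' ≤ hi ∧ (∀ y ∈ R', hi' y = hi y) ∧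
      ∀ y ∉ R', Function.update lo z (max (lo z) (centroid S z - C * clinchEps n C δ)) +
        Pi.single y (clinchTol C δ) ∉ S := by
  have hn : 1 ≤ n := (Nat.zero_le _).trans_lt z.2
  have hlam := clinchTol_pos hC hδ
  have hx := (h.cornerBody G hlam).centroid_mem hn
  have hε := mul_nonneg hC.le (clinchEps_nonneg (n := n) hC hδ)
  set x := centroid S
  rw [h.eq] at hx
  obtain ⟨h1, h2⟩ := lower_update_spec hx.2.1 z hε
  set lo' := Function.update lo z (max (lo z) (x z - C * clinchEps n C δ))
  have h0 : 0 ≤ lo' := h.lo_nonneg.trans h1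
  have hdef : clinchRespond X C δ (.minimize lo hi R S) z
      = minimizeLoop X (clinchTol C δ) lo' hi R S := by
    simp only [clinchRespond, if_pos hz, lo', x]
  rw [hdef]
  refine minimizeLoop_spec hlam h0 (G.downward x hx.1 lo' h0 h2) (h2.trans hx.2.2)
    (fun y hy => ?_) fun y hy hyS => ?_
  · rw [h.eq] at hy
    exact ⟨hy.1, by simpa using hy.2.2 y⟩
  · rw [h.eq] at hyS
    have h3 := hyS.2.2 y
    have h4 := h1 y
    simp only [Pi.add_apply, Pi.single_eq_same, h.locked y hy] at h3
    linarith

lemma clinchRespond_minimize_of_notMem {δ : ℝ} {lo hi : Strategy n} {R : Finset (Fin n)}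
    {S : Set (Strategy n)} {z : Fin n} (hz : z ∉ R) :
    clinchRespond X C δ (.minimize lo hi R S) z
      = conserveLoop (clinchTol C δ) (centroid S)
        (Function.update lo z (max (lo z) (centroid S z - C * clinchEps n C δ)))
        (centroid S) (List.finRange n) := by
  simp only [clinchRespond, if_neg hz]

lemma clinchRespond_feasible (G : IsSecurityGame X u v) (hC : 0 < C) {δ : ℝ} (hδ : 0 < δ)
    {s : ClinchState n} (hs : s.Feasible X (clinchTol C δ)) (z : Fin n) :
    (clinchRespond X C δ s z).Feasible X (clinchTol C δ) := by
  have hn : 1 ≤ n := (Nat.zero_le _).trans_lt z.2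
  have hlam := clinchTol_pos hC hδ
  cases s with
  | minimize lo hi R S =>
    have h : SearchRegion X (clinchTol C δ) lo hi R S := hs
    by_cases hz : z ∈ R
    · obtain ⟨hi', R', S', h1, h2, -⟩ := h.respond G hC hδ hz
      rw [h1]
      exact h2
    · rw [clinchRespond_minimize_of_notMem hz]
      have hx := (h.cornerBody G hlam).centroid_mem hn
      have hε := mul_nonneg hC.le (clinchEps_nonneg (n := n) hC hδ)
      have hxX : centroid S ∈ X ∧ lo ≤ centroid S := by
        have := h.eq.subset hx
        exact ⟨this.1, this.2.1⟩
      obtain ⟨h1, h2⟩ := lower_update_spec hxX.2 z hε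
      exact conserveLoop_feasible G hxX.1 (h.lo_nonneg.trans h1) h2 _
        (h.lo_nonneg.trans hxX.2) le_rfl
  | conserve x lo xhat y ys l r =>
    obtain ⟨hx, hlo0, hlox, h0, hle, hl, hlr, hr⟩ := hs
    have hlo0y : 0 ≤ lo y := hlo0 y
    have key : ∀ l' r' : ℝ, lo y ≤ l' → l' ≤ r' → r' ≤ x y →
        (if clinchTol C δ ≤ r' - l' then ClinchState.conserve x lo xhat y ys l' r'
        else conserveLoop (clinchTol C δ) x lo (Function.update xhat y l') ys).Feasible X
          (clinchTol C δ) := by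
      intro l' r' h1 h2 h3
      split_ifs
      · exact ⟨hx, hlo0, hlox, h0, hle, h1, h2, h3⟩
      · refine conserveLoop_feasible G hx hlo0 hlox ys (fun j => ?_) fun j => ?_
        · by_cases hj : j = y
          · subst hj; simp only [Pi.zero_apply, Function.update_self]; linarith
          · simpa [hj] using h0 j
        · by_cases hj : j = y
          · subst hj; simp only [Function.update_self]; linarith
          · simpa [hj] using hle j
    simp only [clinchRespond]
    refine key _ _ ?_ ?_ ?_ <;> split_ifs <;> linarith
  | done xhat => exact hs

/-! ### Clinch finds the conservative strategy -/

/-- The distances from the conservative strategy `xs` that Clinch maintains if every response is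
an `ε`-best response; `D` bounds the width of the initial box. -/
def ClinchState.Accurate (v : Fin n → ℝ → ℝ) (C δ D : ℝ) (xs : Strategy n) (Vs : ℝ) :
    ClinchState n → Prop
  | .minimize lo hi R _ => lo ≤ xs ∧ (∀ y, hi y ≤ lo y + D) ∧ (∀ y ∈ R, xs y ≤ hi y) ∧
      ∀ y ∉ R, xs y ≤ lo y + clinchTol C δ
  | .conserve x lo xhat y ys l r => lo ≤ xs ∧ (∀ y', x y' ≤ lo y' + D) ∧
      (∀ y', v y' (x y') ≤ Vs + (C * clinchTol C δ + clinchEps n C δ)) ∧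
      (∀ y' ∉ y :: ys, |xhat y' - xs y'| ≤ δ) ∧ l ≤ xs y + C * clinchEps n C δ ∧
      xs y ≤ r + C * (C * clinchTol C δ + 2 * clinchEps n C δ) ∧ clinchTol C δ ≤ r - l
  | .done xhat => ∀ y, |xhat y - xs y| ≤ δ

/-- A bound on the number of queries of the binary search for one target. -/
noncomputable def bisectionBudget (D lam : ℝ) : ℝ := 8 * Real.log (D / lam) + 1

/-- A bound on the number of queries that a run of Clinch still makes. -/
noncomputable def ClinchState.budget (C δ D : ℝ) : ClinchState n → ℝ
  | .minimize lo _ R S =>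
      8 * Real.log (CornerBody.potential R lo (clinchTol C δ) S / (clinchTol C δ / (2 * n)) ^ n) + 1 +
        n * bisectionBudget D (clinchTol C δ)
  | .conserve _ _ _ _ ys l r =>
      8 * Real.log ((r - l) / clinchTol C δ) + 1 + ys.length * bisectionBudget D (clinchTol C δ)
  | .done _ => 0

lemma one_le_bisectionBudget {D lam : ℝ} (hlam : 0 < lam) (hD : lam ≤ D) :
    1 ≤ bisectionBudget D lam := by
  have := Real.log_nonneg ((one_le_div hlam).2 hD)
  unfold bisectionBudget
  linarith

lemma CornerBody.pow_le_potential {lo : Strategy n} {lam : ℝ} {R : Finset (Fin n)}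
    {S : Set (Strategy n)} (h : CornerBody lo lam R S) (hn : 1 ≤ n) :
    (lam / (2 * n)) ^ n ≤ potential R lo lam S := by
  have h1 := h.pow_le_regionVolume hn
  have h2 := h.regionVolume_pos hn
  have h3 : 1 ≤ Real.exp (2 * R.card) := Real.one_le_exp (by positivity)
  unfold potential
  nlinarith

lemma clinch_constants (hC : 1 ≤ C) (hn : 1 ≤ n) {δ : ℝ} (hδ : 0 < δ) :
    C * (C * clinchTol C δ) = δ / 4 ∧ clinchTol C δ ≤ δ / 4 ∧ C * clinchEps n C δ ≤ δ / 33 ∧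
      C * clinchEps n C δ ≤ clinchTol C δ / (4 * n) / 2 := by
  have hn' : (1 : ℝ) ≤ n := by exact_mod_cast hn
  have hC0 : 0 < C := by linarith
  have hCsq : 1 ≤ C ^ 2 := one_le_pow₀ hC
  refine ⟨?_, ?_, ?_, ?_⟩
  · unfold clinchTol; field_simp
  · unfold clinchTol
    exact div_le_div_of_nonneg_left hδ.le (by norm_num) (by linarith)
  · have : C * clinchEps n C δ = δ / (33 * C ^ 2 * n) := by unfold clinchEps; field_simp
    rw [this]
    refine div_le_div_of_nonneg_left hδ.le (by norm_num) ?_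
    nlinarith
  · have h1 : C * clinchEps n C δ = δ / (33 * (C ^ 2 * n)) := by unfold clinchEps; field_simp
    have h2 : clinchTol C δ / (4 * n) / 2 = δ / (32 * (C ^ 2 * n)) := by
      unfold clinchTol; field_simp; norm_num
    rw [h1, h2]
    have : 0 < C ^ 2 * n := by positivity
    exact div_le_div_of_nonneg_left hδ.le (by positivity) (by linarith)

variable {xs : Strategy n} {Vs : ℝ}

lemma conserveLoop_accurate (hc : IsConservative X v W xs Vs) (G : IsSecurityGame X u v)
    (hR : IsRegular X u v C W) (hn : 1 ≤ n) {δ D : ℝ} (hδ : 0 < δ) (hD : clinchTol C δ ≤ D)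
    {x lo : Strategy n} (hx : x ∈ X) (hlo : lo ≤ xs)
    (hxD : ∀ y, x y ≤ lo y + D)
    (hval : ∀ y, v y (x y) ≤ Vs + (C * clinchTol C δ + clinchEps n C δ)) (ys : List (Fin n))
    {xhat : Strategy n} (hhat : ∀ y ∉ ys, |xhat y - xs y| ≤ δ) :
    (conserveLoop (clinchTol C δ) x lo xhat ys).Accurate v C δ D xs Vs ∧
      (conserveLoop (clinchTol C δ) x lo xhat ys).budget C δ D
        ≤ ys.length * bisectionBudget D (clinchTol C δ) := by
  have hlam := clinchTol_pos hR.pos hδ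
  have hε := clinchEps_nonneg (n := n) hR.pos hδ
  have hb := one_le_bisectionBudget hlam hD
  have hCε := mul_nonneg hR.pos.le hε
  obtain ⟨hc1, hc2, hc3, -⟩ := clinch_constants hR.one_le hn hδ
  have hxs : ∀ y, xs y ≤ x y + C * (C * clinchTol C δ + clinchEps n C δ) := fun y =>
    hc.le_add G hR (G.mem_cube x hx y).1 (add_nonneg (mul_nonneg hR.pos.le hlam.le) hε) (hval y)
  induction ys generalizing xhat with
  | nil =>
    refine ⟨fun y => hhat y (by simp), ?_⟩
    simp [conserveLoop, ClinchState.budget]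
  | cons y ys ih =>
    unfold conserveLoop
    split_ifs with h
    · refine ⟨⟨hlo, hxD, hval, hhat, (hlo y).trans (by linarith), (hxs y).trans ?_, h⟩, ?_⟩
      · linarith [mul_add C (C * clinchTol C δ) (clinchEps n C δ),
          mul_add C (C * clinchTol C δ) (2 * clinchEps n C δ)]
      · have : Real.log ((x y - lo y) / clinchTol C δ) ≤ Real.log (D / clinchTol C δ) := by
          refine Real.log_le_log (div_pos (hlam.trans_le h) hlam) ?_
          exact div_le_div_of_nonneg_right (by linarith [hxD y]) hlam.le
        simp only [ClinchState.budget, List.length_cons]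
        push_cast
        rw [add_mul, one_mul, bisectionBudget] at *
        linarith
    · have hhat' : ∀ y' ∉ ys, |Function.update xhat y (lo y) y' - xs y'| ≤ δ := by
        intro y' hy'
        by_cases hj : y' = y
        · subst hj
          rw [Function.update_self, abs_le]
          have h1 := hxs y'
          have h2 := hlo y'
          rw [mul_add, hc1] at h1
          constructor <;> linarith
        · rw [Function.update_of_ne hj]
          exact hhat y' (by simp [hj, hy'])
      obtain ⟨h1, h2⟩ := ih hhat'
      refine ⟨h1, h2.trans ?_⟩
      rw [List.length_cons]
      push_cast
      linarith

lemma clinchState_budget_nonneg (G : IsSecurityGame X u v) (hC : 0 < C) (hn : 1 ≤ n)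
    {δ D : ℝ} (hδ : 0 < δ) (hD : clinchTol C δ ≤ D) {s : ClinchState n}
    (hs : s.Feasible X (clinchTol C δ)) (ha : s.Accurate v C δ D xs Vs) :
    0 ≤ s.budget C δ D := by
  have hlam := clinchTol_pos hC hδ
  have hb := one_le_bisectionBudget hlam hD
  cases s with
  | minimize lo hi R S =>
    have h := SearchRegion.cornerBody hs G hlam
    have h1 := Real.log_nonneg ((one_le_div (pow_pos (h.thickness_pos hn) n)).2
      (h.pow_le_potential hn))
    have : 0 ≤ (n : ℝ) * bisectionBudget D (clinchTol C δ) := by positivity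
    simp only [ClinchState.budget]
    linarith
  | conserve x lo xhat y ys l r =>
    obtain ⟨-, -, -, -, -, -, h⟩ := ha
    have h1 := Real.log_nonneg ((one_le_div hlam).2 h)
    have : 0 ≤ (ys.length : ℝ) * bisectionBudget D (clinchTol C δ) := by positivity
    simp only [ClinchState.budget]
    linarith
  | done xhat => exact le_rfl

/-- A response to an active target raises its lower bound, and the potential of the region
pays for the query. -/
lemma clinchRespond_accurate_of_mem (hc : IsConservative X v W xs Vs) (G : IsSecurityGame X u v)
    (hR : IsRegular X u v C W) {δ D : ℝ} (hδ : 0 < δ) (hD : clinchTol C δ ≤ D)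
    {lo hi : Strategy n} {R : Finset (Fin n)} {S : Set (Strategy n)}
    (h : SearchRegion X (clinchTol C δ) lo hi R S)
    (ha : (ClinchState.minimize lo hi R S).Accurate v C δ D xs Vs) {z : Fin n} (hzR : z ∈ R)
    (hz : ∀ y, payoff v (centroid S) y ≤ payoff v (centroid S) z + clinchEps n C δ) :
    (clinchRespond X C δ (.minimize lo hi R S) z).Accurate v C δ D xs Vs ∧
      (clinchRespond X C δ (.minimize lo hi R S) z).budget C δ D + 1
        ≤ (ClinchState.minimize lo hi R S).budget C δ D := by
  have hn : 1 ≤ n := (Nat.zero_le _).trans_lt z.2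
  have hlam := clinchTol_pos hR.pos hδ
  have hε := clinchEps_nonneg (n := n) hR.pos hδ
  have hb := one_le_bisectionBudget hlam hD
  have hCε := mul_nonneg hR.pos.le hε
  obtain ⟨hc1, hc2, hc3, hc4⟩ := clinch_constants hR.one_le hn hδ
  have hcb := h.cornerBody G hlam
  have hx := h.eq.subset (hcb.centroid_mem hn)
  have hsub := hc.sub_le G hR hx.1 hε hz
  obtain ⟨hlo, hwid, hact, hlock⟩ := ha
  have hpos := pow_pos (hcb.thickness_pos hn) n
  have hlow := lower_update_spec hx.2.1 z hCε
  have hlo' : Function.update lo z (max (lo z) (centroid S z - C * clinchEps n C δ)) ≤ xs := by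
    intro j
    by_cases hj : j = z
    · subst hj; rw [Function.update_self]; exact max_le (hlo j) hsub
    · simpa [hj] using hlo j
  obtain ⟨hi', R', S', h1, h2, hRR, hhi, hhi', hout⟩ := h.respond G hR.pos hδ hzR
  rw [h1]
  have hcb' := h2.cornerBody G hlam
  have hSS : S' ⊆ S := by
    intro x' hx'
    have hx'' := h2.eq.subset hx'
    exact h.eq.superset ⟨hx''.1, hlow.1.trans hx''.2.1, hx''.2.2.trans hhi⟩
  set lo' := Function.update lo z (max (lo z) (centroid S z - C * clinchEps n C δ)) with hlo'_def
  refine ⟨⟨hlo', fun y => ?_, fun y hy => ?_, fun y hy => ?_⟩, ?_⟩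
  · linarith [hhi y, hwid y, hlow.1 y]
  · rw [hhi' y hy]; exact hact y (hRR hy)
  · by_contra! hlt
    refine hout y hy ?_
    by_cases hyR : y ∈ R
    · have hle : lo' + Pi.single y (clinchTol C δ) ≤ xs := by
        intro j
        by_cases hj : j = y
        · subst hj; simpa using hlt.le
        · simpa [hj] using hlo' j
      have hlole : lo ≤ lo' + Pi.single y (clinchTol C δ) := by
        intro j
        by_cases hj : j = y
        · subst hj
          simp only [Pi.add_apply, Pi.single_eq_same]
          linarith [hlow.1 j]
        · simpa [hj] using hlow.1 j
      rw [h.eq]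
      refine ⟨G.downward xs hc.mem _ (h.lo_nonneg.trans hlole) hle, hlole, fun j => ?_⟩
      by_cases hj : j = y
      · subst hj; exact (hle j).trans (hact j hyR)
      · simpa [hj] using (hlow.2 j).trans (hx.2.2 j)
    · linarith [hlock y hyR, hlow.1 y]
  · have hcut : (centroid S z + lo z) / 2 ≤ lo' z := by
      have := hcb.le_centroid hzR
      rw [hlo'_def, Function.update_self]
      refine le_trans ?_ (le_max_right _ _)
      linarith
    have hpot := hcb.potential_le hcb' hRR hSS hlow.1 hzR
      (fun y hy => by simp [hlo'_def, hy]) hcut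
    have hp0 := hpos.trans_le (hcb.pow_le_potential hn)
    have hp0' := hpos.trans_le (hcb'.pow_le_potential hn)
    have h3 : Real.log (CornerBody.potential R' lo' (clinchTol C δ) S' /
          (clinchTol C δ / (2 * n)) ^ n)
        ≤ Real.log (7 / 8) + Real.log (CornerBody.potential R lo (clinchTol C δ) S /
          (clinchTol C δ / (2 * n)) ^ n) := by
      rw [← Real.log_mul (by norm_num) (div_pos hp0 hpos).ne', ← mul_div_assoc]
      exact Real.log_le_log (div_pos hp0' hpos) (div_le_div_of_nonneg_right hpot hpos.le)
    have h4 : Real.log (7 / 8) ≤ -(1 / 8) := by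
      have := Real.log_le_sub_one_of_pos (x := 7 / 8) (by norm_num)
      linarith
    simp only [ClinchState.budget]
    linarith

/-- A response to a locked target shows that every target is defended well enough. -/
lemma clinchRespond_accurate_of_notMem (hc : IsConservative X v W xs Vs) (G : IsSecurityGame X u v)
    (hR : IsRegular X u v C W) {δ D : ℝ} (hδ : 0 < δ) (hD : clinchTol C δ ≤ D)
    {lo hi : Strategy n} {R : Finset (Fin n)} {S : Set (Strategy n)}
    (h : SearchRegion X (clinchTol C δ) lo hi R S)
    (ha : (ClinchState.minimize lo hi R S).Accurate v C δ D xs Vs) {z : Fin n} (hzR : z ∉ R)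
    (hz : ∀ y, payoff v (centroid S) y ≤ payoff v (centroid S) z + clinchEps n C δ) :
    (clinchRespond X C δ (.minimize lo hi R S) z).Accurate v C δ D xs Vs ∧
      (clinchRespond X C δ (.minimize lo hi R S) z).budget C δ D + 1
        ≤ (ClinchState.minimize lo hi R S).budget C δ D := by
  have hn : 1 ≤ n := (Nat.zero_le _).trans_lt z.2
  have hlam := clinchTol_pos hR.pos hδ
  have hε := clinchEps_nonneg (n := n) hR.pos hδ
  have hb := one_le_bisectionBudget hlam hD
  have hCε := mul_nonneg hR.pos.le hε
  obtain ⟨hc1, hc2, hc3, hc4⟩ := clinch_constants hR.one_le hn hδ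
  have hcb := h.cornerBody G hlam
  have hx := h.eq.subset (hcb.centroid_mem hn)
  have hsub := hc.sub_le G hR hx.1 hε hz
  obtain ⟨hlo, hwid, hact, hlock⟩ := ha
  have hpos := pow_pos (hcb.thickness_pos hn) n
  rw [clinchRespond_minimize_of_notMem hzR]
  have hxz : centroid S z = lo z :=
    le_antisymm ((hx.2.2 z).trans_eq (h.locked z hzR)) (hx.2.1 z)
  have hloeq : Function.update lo z (max (lo z) (centroid S z - C * clinchEps n C δ)) = lo := by
    rw [hxz, max_eq_left (by linarith), Function.update_eq_self]
  rw [hloeq]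
  have hval := hc.payoff_le G hR hx.1 hlam.le (hxz ▸ hlock z hzR) hz
  obtain ⟨h1, h2⟩ := conserveLoop_accurate hc G hR hn hδ hD hx.1 hlo
    (fun y => (hx.2.2 y).trans (hwid y)) hval (List.finRange n) (xhat := centroid S)
    (fun y hy => (hy (List.mem_finRange y)).elim)
  refine ⟨h1, ?_⟩
  have h3 := Real.log_nonneg ((one_le_div hpos).2 (hcb.pow_le_potential hn))
  rw [List.length_finRange] at h2
  simp only [ClinchState.budget] at h2 ⊢
  linarith

/-- A step of the binary search for a target. -/
lemma clinchRespond_accurate_conserve (hc : IsConservative X v W xs Vs) (G : IsSecurityGame X u v)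
    (hR : IsRegular X u v C W) {δ D : ℝ} (hδ : 0 < δ) (hD : clinchTol C δ ≤ D)
    {x lo xhat : Strategy n} {y : Fin n} {ys : List (Fin n)} {l r : ℝ}
    (hs : (ClinchState.conserve x lo xhat y ys l r).Feasible X (clinchTol C δ))
    (ha : (ClinchState.conserve x lo xhat y ys l r).Accurate v C δ D xs Vs) {z : Fin n}
    (hz : ∀ y', payoff v (Function.update x y ((r + l) / 2)) y'
      ≤ payoff v (Function.update x y ((r + l) / 2)) z + clinchEps n C δ) :
    (clinchRespond X C δ (.conserve x lo xhat y ys l r) z).Accurate v C δ D xs Vs ∧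
      (clinchRespond X C δ (.conserve x lo xhat y ys l r) z).budget C δ D + 1
        ≤ (ClinchState.conserve x lo xhat y ys l r).budget C δ D := by
  have hn : 1 ≤ n := (Nat.zero_le _).trans_lt z.2
  have hlam := clinchTol_pos hR.pos hδ
  have hε := clinchEps_nonneg (n := n) hR.pos hδ
  have hb := one_le_bisectionBudget hlam hD
  have hCε := mul_nonneg hR.pos.le hε
  obtain ⟨hc1, hc2, hc3, hc4⟩ := clinch_constants hR.one_le hn hδ
  have hsub := hc.sub_le G hR (clinchQuery_mem G hn hlam hs) hε hz
  obtain ⟨hx, hlo0, hlox, h0, hle, hl, hlr, hr⟩ := hs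
  obtain ⟨hlo, hxD, hval, hhat, hlxs, hxsr, hrl⟩ := ha
  have hlo0y : 0 ≤ lo y := hlo0 y
  have hC := hR.pos
  simp only [clinchQuery] at hsub
  have hlow : z = y → (r + l) / 2 ≤ xs y + C * clinchEps n C δ := by
    rintro rfl
    rw [Function.update_self] at hsub
    linarith
  have hupp : z ≠ y → xs y ≤ (r + l) / 2 + C * (C * clinchTol C δ + 2 * clinchEps n C δ) := by
    intro hzy
    have h1 := hz y
    simp only [payoff, Function.update_self, Function.update_of_ne hzy] at h1
    refine hc.le_add G hR (by linarith) (by positivity) ?_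
    linarith [hval z]
  have key : ∀ l' r' : ℝ, r' - l' = (r - l) / 2 → l' ≤ xs y + C * clinchEps n C δ →
      xs y ≤ r' + C * (C * clinchTol C δ + 2 * clinchEps n C δ) →
      (if clinchTol C δ ≤ r' - l' then ClinchState.conserve x lo xhat y ys l' r'
        else conserveLoop (clinchTol C δ) x lo (Function.update xhat y l') ys).Accurate
          v C δ D xs Vs ∧
      (if clinchTol C δ ≤ r' - l' then ClinchState.conserve x lo xhat y ys l' r'
        else conserveLoop (clinchTol C δ) x lo (Function.update xhat y l') ys).budget C δ D + 1
        ≤ 8 * Real.log ((r - l) / clinchTol C δ) + 1 +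
          ys.length * bisectionBudget D (clinchTol C δ) := by
    intro l' r' h1 h2 h3
    split_ifs with h4
    · refine ⟨⟨hlo, hxD, hval, hhat, h2, h3, h4⟩, ?_⟩
      simp only [ClinchState.budget]
      have : (r' - l') / clinchTol C δ = (r - l) / clinchTol C δ / 2 := by rw [h1]; ring
      rw [this, Real.log_div (div_pos (hlam.trans_le hrl) hlam).ne' two_ne_zero]
      linarith [Real.log_two_gt_d9]
    · have hhat' : ∀ y' ∉ ys, |Function.update xhat y l' y' - xs y'| ≤ δ := by
        intro y' hy'
        by_cases hj : y' = y
        · subst hj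
          rw [Function.update_self, abs_le]
          rw [mul_add, hc1] at h3
          constructor <;> linarith
        · rw [Function.update_of_ne hj]
          exact hhat y' (by simp [hj, hy'])
      obtain ⟨h5, h6⟩ := conserveLoop_accurate hc G hR hn hδ hD hx hlo hxD hval ys hhat'
      have := Real.log_nonneg ((one_le_div hlam).2 hrl)
      exact ⟨h5, by linarith⟩
  simp only [clinchRespond]
  change _ ∧ _ ≤ 8 * Real.log ((r - l) / clinchTol C δ) + 1 +
          ys.length * bisectionBudget D (clinchTol C δ)
  by_cases hzy : z = y
  · simp only [if_pos hzy]
    exact key _ _ (by ring) (hlow hzy) hxsr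
  · simp only [if_neg hzy]
    exact key _ _ (by ring) hlxs (hupp hzy)

/-- One query of Clinch, answered by an approximate best response. -/
lemma clinchRespond_accurate (hc : IsConservative X v W xs Vs) (G : IsSecurityGame X u v)
    (hR : IsRegular X u v C W) {δ D : ℝ} (hδ : 0 < δ) (hD : clinchTol C δ ≤ D)
    {s : ClinchState n} (hs : s.Feasible X (clinchTol C δ)) (ha : s.Accurate v C δ D xs Vs)
    (hdone : ∀ xhat, s ≠ .done xhat) {z : Fin n}
    (hz : ∀ y, payoff v (clinchQuery s) y ≤ payoff v (clinchQuery s) z + clinchEps n C δ) :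
    (clinchRespond X C δ s z).Accurate v C δ D xs Vs ∧
      (clinchRespond X C δ s z).budget C δ D + 1 ≤ s.budget C δ D := by
  cases s with
  | minimize lo hi R S =>
    by_cases hzR : z ∈ R
    · exact clinchRespond_accurate_of_mem hc G hR hδ hD hs ha hzR hz
    · exact clinchRespond_accurate_of_notMem hc G hR hδ hD hs ha hzR hz
  | conserve x lo xhat y ys l r => exact clinchRespond_accurate_conserve hc G hR hδ hD hs ha hz
  | done xhat => exact (hdone xhat rfl).elim

/-- The number of queries that a run of Clinch on a box of width `D` needs. -/
noncomputable def runBudget (n : ℕ) (D lam : ℝ) : ℝ :=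
  8 * (n * (Real.log (D / lam * (2 * n)) + 2)) + 1 + n * bisectionBudget D lam

lemma clinchInit_accurate (hc : IsConservative X v W xs Vs) (G : IsSecurityGame X u v)
    (hR : IsRegular X u v C W) (hn : 1 ≤ n) {δ D : ℝ} (hδ : 0 < δ) {lo hi : Strategy n}
    (hlo0 : 0 ≤ lo) (hlohi : ∀ y, lo y + clinchTol C δ ≤ hi y) (hD : ∀ y, hi y ≤ lo y + D)
    (hlo : lo ≤ xs) (hhi : xs ≤ hi) :
    (clinchInit X C δ lo hi).Accurate v C δ D xs Vs ∧
      (clinchInit X C δ lo hi).budget C δ D ≤ runBudget n D (clinchTol C δ) := by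
  have hlam := clinchTol_pos hR.pos hδ
  obtain ⟨hi', R', S', h1, h2, h3, h4, h5⟩ := clinchInit_spec hlam hlo0
    (G.downward xs hc.mem lo hlo0 hlo) hlohi
  rw [h1]
  have hcb := h2.cornerBody G hlam
  have hDlam : clinchTol C δ ≤ D := by
    have y : Fin n := ⟨0, hn⟩
    linarith [hlohi y, hD y]
  have hn' : (1 : ℝ) ≤ n := by exact_mod_cast hn
  refine ⟨⟨hlo, fun y => (h3 y).trans (hD y), fun y hy => (hhi y).trans_eq (h4 y hy).symm,
    fun y hy => ?_⟩, ?_⟩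
  · by_contra! hlt
    refine h5 y hy (G.downward xs hc.mem _ (hlo0.trans fun j => ?_) fun j => ?_)
    · by_cases hj : j = y
      · subst hj; simpa using hlam.le
      · simp [hj]
    · by_cases hj : j = y
      · subst hj; simpa using hlt.le
      · simpa [hj] using hlo j
  · have hvol := hcb.regionVolume_le hn ((hcb.thickness_le hn).trans hDlam) fun x hx y => by
      rw [h2.eq] at hx
      exact (hx.2.2 y).trans ((h3 y).trans (hD y))
    have hD0 : 0 < D := hlam.trans_le hDlam
    have hcard : (R'.card : ℝ) ≤ n := by
      exact_mod_cast (Finset.card_le_univ R').trans_eq (Fintype.card_fin n)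
    have hpot : CornerBody.potential R' lo (clinchTol C δ) S' ≤ D ^ n * Real.exp (2 * n) := by
      unfold CornerBody.potential
      gcongr
    have hpos := pow_pos (hcb.thickness_pos hn) n
    have hlog : Real.log (CornerBody.potential R' lo (clinchTol C δ) S' /
        (clinchTol C δ / (2 * n)) ^ n) ≤ n * (Real.log (D / clinchTol C δ * (2 * n)) + 2) := by
      calc _ ≤ Real.log (D ^ n * Real.exp (2 * n) / (clinchTol C δ / (2 * n)) ^ n) :=
            Real.log_le_log (div_pos (hpos.trans_le (hcb.pow_le_potential hn)) hpos)
              (div_le_div_of_nonneg_right hpot hpos.le)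
        _ = Real.log ((D / clinchTol C δ * (2 * n)) ^ n * Real.exp (2 * n)) := by
            congr 1
            rw [mul_div_right_comm, ← div_pow]
            congr 2
            field_simp
        _ = _ := by
            rw [Real.log_mul (by positivity) (Real.exp_pos _).ne', Real.log_exp, Real.log_pow]
            ring
    simp only [ClinchState.budget, runBudget]
    linarith

end

/-! ### Epoch parameters -/

section

variable {X : Set (Strategy n)} {u v : Fin n → ℝ → ℝ} {C W γ : ℝ} {T : ℕ}

lemma IsRegular.width_le_one [Nonempty (Fin n)] (hR : IsRegular X u v C W)
    (G : IsSecurityGame X u v) : W ≤ 1 := by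
  obtain ⟨x, hx⟩ := G.nonempty
  obtain ⟨y, hy⟩ := exists_bestResponse v x
  obtain ⟨a, ha, b, hb, hab⟩ := hR.width y ⟨x, hx, hy⟩
  linarith [(G.mem_cube a ha.1 y).2, (G.mem_cube b hb.1 y).1]

/-- The width of the box of epoch `φ`, and also the regret bound of its exploit strategy. -/
noncomputable def epochWidth (φ : ℕ) : ℝ := 2 / 2 ^ φ

lemma epochWidth_pos (φ : ℕ) : 0 < epochWidth φ := by unfold epochWidth; positivity

lemma epochLam_pos (hC : 0 < C) (φ : ℕ) : 0 < epochLam C φ := by unfold epochLam; positivity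

lemma epochLam_le_one (hC : 1 ≤ C) (φ : ℕ) : epochLam C φ ≤ 1 := by
  unfold epochLam
  have : (1 : ℝ) ≤ 2 ^ φ := one_le_pow₀ (by norm_num)
  rw [div_le_one (by positivity)]
  nlinarith

lemma epochDelta_pos (hC : 0 < C) (hW : 0 < W) (φ : ℕ) : 0 < epochDelta C W φ := by
  have := epochLam_pos hC φ
  unfold epochDelta
  positivity

lemma epochDelta_succ (φ : ℕ) : epochDelta C W (φ + 1) = epochDelta C W φ / 2 := by
  unfold epochDelta epochLam
  rw [pow_succ]
  ring

lemma epochDelta_le (hC : 1 ≤ C) (hW : 0 < W) (hW1 : W ≤ 1) (φ : ℕ) :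
    epochDelta C W φ ≤ epochWidth (φ + 1) / 2 := by
  have h : epochDelta C W φ = W / (6 * C ^ 3) * (1 / 2 ^ φ) := by
    unfold epochDelta epochLam; field_simp
  have h2 : epochWidth (φ + 1) / 2 = 1 / 2 * (1 / 2 ^ φ) := by
    unfold epochWidth; rw [pow_succ]; field_simp
  rw [h, h2]
  refine mul_le_mul_of_nonneg_right ?_ (by positivity)
  rw [div_le_div_iff₀ (by positivity) (by norm_num)]
  have : 1 ≤ C ^ 3 := one_le_pow₀ hC
  linarith

lemma epochWidth_le_one (φ : ℕ) : epochWidth (φ + 1) ≤ 1 := by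
  unfold epochWidth
  have : (1 : ℝ) ≤ 2 ^ φ := one_le_pow₀ (by norm_num)
  rw [pow_succ, div_le_one (by positivity)]
  linarith

lemma epochWidth_div (hC : 0 < C) (hW : 0 < W) (φ : ℕ) :
    epochWidth φ / clinchTol C (epochDelta C W φ) = 48 * C ^ 5 / W := by
  unfold epochWidth clinchTol epochDelta epochLam
  field_simp
  norm_num

lemma clinchTol_le_epochWidth (hC : 1 ≤ C) (hW : 0 < W) (hW1 : W ≤ 1) (φ : ℕ) :
    clinchTol C (epochDelta C W φ) ≤ epochWidth φ := by
  have hC0 : 0 < C := by linarith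
  have h := epochWidth_div hC0 hW φ
  have htol := clinchTol_pos hC0 (epochDelta_pos hC0 hW φ)
  rw [← one_le_div htol, h, one_le_div hW]
  have : 1 ≤ C ^ 5 := one_le_pow₀ hC
  linarith

lemma clinchTol_le (hC : 1 ≤ C) {δ : ℝ} (hδ : 0 ≤ δ) : clinchTol C δ ≤ δ := by
  unfold clinchTol
  have : 1 ≤ C ^ 2 := one_le_pow₀ hC
  exact div_le_self hδ (by linarith)

lemma one_le_discountHorizon (h0 : 0 < γ) (h1 : γ < 1) : 1 ≤ discountHorizon γ := by
  unfold discountHorizon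
  rw [one_le_div (by linarith)]
  linarith

lemma one_lt_log_argument (hn : 1 ≤ n) (hC : 1 ≤ C) (hW : 0 < W) (hW1 : W ≤ 1) (h0 : 0 < γ)
    (h1 : γ < 1) (φ : ℕ) :
    1 < 200 * discountHorizon γ * C ^ 5 * n / (W * epochLam C φ) := by
  have hn' : (1 : ℝ) ≤ n := by exact_mod_cast hn
  have hT := one_le_discountHorizon h0 h1
  have hl := epochLam_pos (C := C) (by linarith) φ
  have hl1 := epochLam_le_one hC φ
  have hC5 : 1 ≤ C ^ 5 := one_le_pow₀ hC
  rw [one_lt_div (by positivity)]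
  have h2 : W * epochLam C φ ≤ 1 := mul_le_one₀ hW1 hl.le hl1
  have h3 : 1 ≤ discountHorizon γ * C ^ 5 * n :=
    one_le_mul_of_one_le_of_one_le (one_le_mul_of_one_le_of_one_le hT hC5) hn'
  linarith

lemma exploitLength_pos (hn : 1 ≤ n) (hC : 1 ≤ C) (hW : 0 < W) (hW1 : W ≤ 1) (h0 : 0 < γ)
    (h1 : γ < 1) (φ : ℕ) : 0 < exploitLength n C W γ φ := by
  have hT := one_le_discountHorizon h0 h1
  unfold exploitLength
  rw [Nat.ceil_pos]
  exact mul_pos (by linarith) (Real.log_pos (one_lt_log_argument hn hC hW hW1 h0 h1 φ))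

/-- After the exploit rounds of a batch the discounted future is worth less than the accuracy of
best responses that Clinch expects. -/
lemma pow_exploitLength_le (hn : 1 ≤ n) (hC : 1 ≤ C) (hW : 0 < W) (hW1 : W ≤ 1) (h0 : 0 < γ)
    (h1 : γ < 1) (φ : ℕ) :
    γ ^ exploitLength n C W γ φ * discountHorizon γ ≤ clinchEps n C (epochDelta C W φ) := by
  have hn' : (1 : ℝ) ≤ n := by exact_mod_cast hn
  have hC0 : 0 < C := by linarith
  have hT := one_le_discountHorizon h0 h1
  have hT0 : 0 < discountHorizon γ := by linarith
  have hl := epochLam_pos hC0 φ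
  have harg := one_lt_log_argument hn hC hW hW1 h0 h1 φ
  set a := 200 * discountHorizon γ * C ^ 5 * n / (W * epochLam C φ) with ha
  set L := exploitLength n C W γ φ with hL
  have hLa : discountHorizon γ * Real.log a ≤ L := Nat.le_ceil _
  have h2 : (1 - γ) * discountHorizon γ = 1 := by
    unfold discountHorizon
    exact mul_one_div_cancel (by linarith)
  have h3 : Real.log a ≤ (1 - γ) * L := by
    have := mul_le_mul_of_nonneg_left hLa (show 0 ≤ 1 - γ by linarith)
    rwa [← mul_assoc, h2, one_mul] at this
  have h4 : Real.log γ ≤ -(1 - γ) := by linarith [Real.log_le_sub_one_of_pos h0]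
  have h5 : γ ^ L ≤ a⁻¹ := by
    have hpos : 0 < a := by linarith
    rw [← Real.log_le_log_iff (by positivity) (by positivity), Real.log_pow, Real.log_inv]
    have : (L : ℝ) * Real.log γ ≤ L * -(1 - γ) := mul_le_mul_of_nonneg_left h4 (by positivity)
    linarith
  have h6 : a⁻¹ * discountHorizon γ = W * epochLam C φ / (200 * (C ^ 5 * n)) := by
    rw [ha]; field_simp
  have h7 : clinchEps n C (epochDelta C W φ) = W * epochLam C φ / (198 * (C ^ 5 * n)) := by
    unfold clinchEps epochDelta; field_simp; norm_num
  have h8 : 0 < C ^ 5 * n := by positivity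
  calc γ ^ L * discountHorizon γ ≤ a⁻¹ * discountHorizon γ :=
        mul_le_mul_of_nonneg_right h5 hT0.le
    _ ≤ _ := by
        rw [h6, h7]
        exact div_le_div_of_nonneg_left (by positivity) (by positivity) (by linarith)

/-! ### BatchedClinch plays feasible strategies -/

/-- The state of BatchedClinch after a history. -/
noncomputable def batchState (X : Set (Strategy n)) (u : Fin n → ℝ → ℝ) (C W γ : ℝ) (T : ℕ)
    (H : History n) : BatchState n :=
  H.foldl (fun s p => batchRespond X u C W γ T s p.2) (batchInit X C W)

lemma batchState_append (H : History n) (p : Strategy n × Fin n) :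
    batchState X u C W γ T (H ++ [p])
      = batchRespond X u C W γ T (batchState X u C W γ T H) p.2 := by
  simp [batchState]

lemma batchFinish_of_wait {s : BatchState n} (h : s.wait ≠ 0) : batchFinish X u C W s = s := by
  unfold batchFinish
  split
  · rename_i h1 _
    exact (h h1).elim
  · rfl

lemma batchFinish_of_run {s : BatchState n} (h : ∀ xhat, s.run ≠ .done xhat) :
    batchFinish X u C W s = s := by
  unfold batchFinish
  split
  · rename_i xhat _ h1
    exact (h xhat h1).elim
  · rfl

lemma batchFinish_done {s : BatchState n} (h : s.wait = 0) {xhat : Strategy n}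
    (hd : s.run = .done xhat) :
    batchFinish X u C W s =
      { epoch := s.epoch + 1
        run := clinchInit X C (epochDelta C W (s.epoch + 1))
          (fun y => max (xhat y - epochDelta C W s.epoch) 0)
          (fun y => min (xhat y + epochDelta C W s.epoch) 1)
        exploit := perturb u W xhat (epochLam C s.epoch)
        wait := 0 } := by
  unfold batchFinish
  rw [h, hd]
  rfl

/-- The part of the structural invariant of BatchedClinch that also holds between a round and the
update at the end of a batch. -/
structure BatchState.FeasibleCore (X : Set (Strategy n)) (C W : ℝ) (s : BatchState n) : Prop where
  epoch_pos : 1 ≤ s.epoch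
  run : s.run.Feasible X (clinchTol C (epochDelta C W s.epoch))
  exploit : s.exploit ∈ X

/-- Structural invariant of BatchedClinch, valid for arbitrary responses. -/
structure BatchState.Feasible (X : Set (Strategy n)) (C W : ℝ) (s : BatchState n) : Prop
    extends BatchState.FeasibleCore X C W s where
  not_done : s.wait = 0 → ∀ xhat, s.run ≠ .done xhat

/-- The new box around `xhat` is wide enough for Clinch. -/
lemma box_spec (G : IsSecurityGame X u v) (hC : 1 ≤ C) (hW : 0 < W) (hW1 : W ≤ 1) (φ : ℕ)
    {xhat : Strategy n} (hx : xhat ∈ X) :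
    (fun y => max (xhat y - epochDelta C W φ) 0) ∈ X ∧
      (0 : Strategy n) ≤ (fun y => max (xhat y - epochDelta C W φ) 0) ∧
      ∀ y, max (xhat y - epochDelta C W φ) 0 + clinchTol C (epochDelta C W (φ + 1))
        ≤ min (xhat y + epochDelta C W φ) 1 := by
  have hδ := epochDelta_pos (C := C) (by linarith) hW φ
  have h0 : (0 : Strategy n) ≤ (fun y => max (xhat y - epochDelta C W φ) 0) :=
    fun y => le_max_right _ _
  refine ⟨G.downward xhat hx _ h0 fun y => max_le (by linarith) (G.mem_cube xhat hx y).1, h0,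
    fun y => ?_⟩
  have h1 := epochDelta_le hC hW hW1 φ
  have h2 := epochWidth_le_one φ
  have h3 := clinchTol_le hC (epochDelta_pos (C := C) (by linarith) hW (φ + 1)).le
  rw [epochDelta_succ] at h3 ⊢
  obtain ⟨h4, h5⟩ := G.mem_cube xhat hx y
  rcases max_cases (xhat y - epochDelta C W φ) 0 with ⟨h, -⟩ | ⟨h, -⟩ <;> rw [h] <;>
    exact le_min (by linarith) (by linarith)

lemma clinchInit_feasible {δ : ℝ} (hlam : 0 < clinchTol C δ) {lo hi : Strategy n} (hlo0 : 0 ≤ lo)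
    (hloX : lo ∈ X) (hlohi : ∀ y, lo y + clinchTol C δ ≤ hi y) :
    (clinchInit X C δ lo hi).Feasible X (clinchTol C δ) ∧
      ∀ xhat, clinchInit X C δ lo hi ≠ .done xhat := by
  obtain ⟨hi', R', S', h1, h2, -⟩ := clinchInit_spec hlam hlo0 hloX hlohi
  rw [h1]
  exact ⟨h2, by simp⟩

lemma zero_mem (G : IsSecurityGame X u v) : (0 : Strategy n) ∈ X := by
  obtain ⟨x, hx⟩ := G.nonempty
  exact G.downward x hx 0 le_rfl fun y => (G.mem_cube x hx y).1

lemma first_box (hC : 1 ≤ C) (hW : 0 < W) (hW1 : W ≤ 1) (y : Fin n) :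
    (0 : Strategy n) y + clinchTol C (epochDelta C W 1) ≤ (1 : Strategy n) y := by
  have h1 := clinchTol_le_epochWidth hC hW hW1 1
  have h2 := epochWidth_le_one 0
  rw [zero_add] at h2
  simpa using h1.trans h2

lemma batchInit_feasible (G : IsSecurityGame X u v) (hC : 1 ≤ C) (hW : 0 < W) (hW1 : W ≤ 1) :
    (batchInit X C W).Feasible X C W := by
  have hC0 : 0 < C := by linarith
  have h := clinchInit_feasible (X := X) (clinchTol_pos hC0 (epochDelta_pos hC0 hW 1)) le_rfl
    (zero_mem G) (first_box hC hW hW1)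
  exact ⟨⟨le_rfl, h.1, zero_mem G⟩, fun _ => h.2⟩

lemma batchFinish_feasible (G : IsSecurityGame X u v) (hC : 1 ≤ C) (hW : 0 < W) (hW1 : W ≤ 1)
    {s : BatchState n} (hs : s.FeasibleCore X C W) :
    (batchFinish X u C W s).Feasible X C W := by
  have hC0 : 0 < C := by linarith
  by_cases hw : s.wait = 0
  · by_cases hd : ∃ xhat, s.run = .done xhat
    · obtain ⟨xhat, hd⟩ := hd
      have hx : xhat ∈ X := by
        have := hs.run
        rw [hd] at this
        exact this
      rw [batchFinish_done hw hd]
      obtain ⟨h1, h2, h3⟩ := box_spec G hC hW hW1 s.epoch hx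
      have h := clinchInit_feasible (X := X)
        (clinchTol_pos hC0 (epochDelta_pos hC0 hW (s.epoch + 1))) h2 h1 h3
      exact ⟨⟨Nat.le_add_left _ _, h.1, perturb_mem G hW hx (epochLam_pos hC0 _).le
        (epochLam_le_one hC _)⟩, fun _ => h.2⟩
    · push Not at hd
      rw [batchFinish_of_run hd]
      exact ⟨hs, fun _ => hd⟩
  · rw [batchFinish_of_wait hw]
    exact ⟨hs, fun h => (hw h).elim⟩

lemma batchRespond_feasible (G : IsSecurityGame X u v) (hC : 1 ≤ C) (hW : 0 < W) (hW1 : W ≤ 1)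
    {s : BatchState n} (hs : s.Feasible X C W) (z : Fin n) :
    (batchRespond X u C W γ T s z).Feasible X C W := by
  have hC0 : 0 < C := by linarith
  unfold batchRespond
  split_ifs
  · exact hs
  · exact batchFinish_feasible G hC hW hW1 ⟨hs.epoch_pos,
      clinchRespond_feasible G hC0 (epochDelta_pos hC0 hW _) hs.run z, hs.exploit⟩
  · exact batchFinish_feasible G hC hW hW1 ⟨hs.epoch_pos, hs.run, hs.exploit⟩

lemma batchState_feasible (G : IsSecurityGame X u v) (hC : 1 ≤ C) (hW : 0 < W) (hW1 : W ≤ 1)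
    (H : History n) : (batchState X u C W γ T H).Feasible X C W := by
  induction H using List.reverseRecOn with
  | nil => exact batchInit_feasible G hC hW hW1
  | append_singleton H p ih =>
    rw [batchState_append]
    exact batchRespond_feasible G hC hW hW1 ih p.2

lemma batchPlay_mem (G : IsSecurityGame X u v) (hn : 1 ≤ n) (hC : 1 ≤ C) (hW : 0 < W)
    {s : BatchState n} (hs : s.Feasible X C W) : batchPlay T s ∈ X := by
  have hC0 : 0 < C := by linarith
  unfold batchPlay
  split_ifs
  · exact hs.exploit
  · exact clinchQuery_mem G hn (clinchTol_pos hC0 (epochDelta_pos hC0 hW _)) hs.run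

/-- BatchedClinch always plays feasible strategies. -/
lemma batchedClinch_mem (G : IsSecurityGame X u v) (hn : 1 ≤ n) (hC : 1 ≤ C) (hW : 0 < W)
    (hW1 : W ≤ 1) (H : History n) : batchedClinch X u C W γ T H ∈ X :=
  batchPlay_mem G hn hC hW (batchState_feasible G hC hW hW1 H)

lemma batchRespond_explore {s : BatchState n} (he : ¬ Nat.clog 2 T < s.epoch) (hw : s.wait = 0)
    (hL : 0 < exploitLength n C W γ s.epoch) (z : Fin n) :
    batchRespond X u C W γ T s z =
      { s with
        run := clinchRespond X C (epochDelta C W s.epoch) s.run z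
        wait := exploitLength n C W γ s.epoch } := by
  unfold batchRespond
  rw [if_neg he, if_pos hw, batchFinish_of_wait]
  exact hL.ne'

lemma batchRespond_exploit {s : BatchState n} (he : ¬ Nat.clog 2 T < s.epoch) (hw : s.wait ≠ 0)
    (z : Fin n) :
    batchRespond X u C W γ T s z = batchFinish X u C W { s with wait := s.wait - 1 } := by
  unfold batchRespond
  rw [if_neg he, if_neg hw]

/-! ### Discounting agents are nearly myopic against BatchedClinch -/

section

variable {A : PrincipalPolicy n}

lemma continuationValue_nonneg (hγ : 0 < γ) (hA : ∀ H y, 0 ≤ payoff v (A H) y) (k : ℕ)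
    (H : History n) : 0 ≤ continuationValue γ v A k H := by
  induction k generalizing H with
  | zero => exact le_rfl
  | succ k ih =>
    refine Real.iSup_nonneg fun y => add_nonneg (mul_nonneg (by positivity) (hA H y)) (ih _)

lemma continuationValue_le (hγ : 0 < γ) (hγ1 : γ < 1) (hA : ∀ H y, payoff v (A H) y ≤ 1)
    (k : ℕ) (H : History n) :
    continuationValue γ v A k H ≤ γ ^ (H.length + 1) * discountHorizon γ := by
  have hT := one_le_discountHorizon hγ hγ1
  have hT0 : 0 ≤ discountHorizon γ := by linarith
  induction k generalizing H with
  | zero => exact mul_nonneg (by positivity) hT0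
  | succ k ih =>
    refine Real.iSup_le (fun y => ?_) (mul_nonneg (by positivity) hT0)
    have h1 := ih (H ++ [(A H, y)])
    rw [List.length_append, List.length_singleton, pow_succ, mul_assoc] at h1
    have h2 : γ * discountHorizon γ = discountHorizon γ - 1 := by
      have : 1 - γ ≠ 0 := by linarith
      unfold discountHorizon; field_simp; ring
    rw [h2, mul_sub, mul_one] at h1
    have h3 : γ ^ (H.length + 1) * payoff v (A H) y ≤ γ ^ (H.length + 1) :=
      mul_le_of_le_one_right (by positivity) (hA H y)
    linarith

end

lemma continuationValue_congr {k : ℕ} {H H' : History n} (hl : H.length = H'.length)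
    (hs : batchState X u C W γ T H = batchState X u C W γ T H') :
    continuationValue γ v (batchedClinch X u C W γ T) k H
      = continuationValue γ v (batchedClinch X u C W γ T) k H' := by
  induction k generalizing H H' with
  | zero => rfl
  | succ k ih =>
    have hA : batchedClinch X u C W γ T H = batchedClinch X u C W γ T H' :=
      congrArg (batchPlay T) hs
    unfold continuationValue
    refine iSup_congr fun y => ?_
    rw [hl, hA, ih (H := H ++ [(batchedClinch X u C W γ T H', y)])
      (H' := H' ++ [(batchedClinch X u C W γ T H', y)]) (by simp [hl])
      (by rw [batchState_append, batchState_append, hs])]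

/-- While the exploit strategy is played, the agent's past responses do not matter; so they can
change its future utility only by what is discounted beyond the current batch. -/
lemma continuationValue_sub_le [Nonempty (Fin n)] (G : IsSecurityGame X u v) (hn : 1 ≤ n)
    (hC : 1 ≤ C) (hW : 0 < W) (hW1 : W ≤ 1) (hγ : 0 < γ) (hγ1 : γ < 1) (w k : ℕ)
    {H H' : History n} (hl : H.length = H'.length)
    (hw : (batchState X u C W γ T H).wait = w) (hw' : (batchState X u C W γ T H').wait = w)
    (he : (batchState X u C W γ T H).epoch = (batchState X u C W γ T H').epoch)
    (hle : ¬ Nat.clog 2 T < (batchState X u C W γ T H).epoch)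
    (hx : (batchState X u C W γ T H).exploit = (batchState X u C W γ T H').exploit) :
    continuationValue γ v (batchedClinch X u C W γ T) k H
        - continuationValue γ v (batchedClinch X u C W γ T) k H'
      ≤ γ ^ (H.length + 1 + w) * discountHorizon γ := by
  have hmem := batchedClinch_mem (γ := γ) (T := T) G hn hC hW hW1
  have hv : ∀ H y, payoff v (batchedClinch X u C W γ T H) y ∈ Icc (0 : ℝ) 1 := fun H y =>
    G.v_mapsTo y (G.mem_cube _ (hmem H) y)
  have hT := one_le_discountHorizon hγ hγ1
  have base : ∀ k, ∀ H H' : History n, continuationValue γ v (batchedClinch X u C W γ T) k H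
        - continuationValue γ v (batchedClinch X u C W γ T) k H'
      ≤ γ ^ (H.length + 1) * discountHorizon γ := fun k H H' => by
    have h1 := continuationValue_le hγ hγ1 (fun H y => (hv H y).2) k H
    have h2 := continuationValue_nonneg (A := batchedClinch X u C W γ T) hγ
      (fun H y => (hv H y).1) k H'
    linarith
  induction w generalizing k H H' with
  | zero => exact base k H H'
  | succ w ih =>
    cases k with
    | zero =>
      simp only [continuationValue, sub_self]
      exact mul_nonneg (by positivity) (by linarith)
    | succ k =>
      have hplay : ∀ H : History n, (batchState X u C W γ T H).wait = w + 1 →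
          batchedClinch X u C W γ T H = (batchState X u C W γ T H).exploit := fun H hH =>
        if_pos (Or.inr (ne_of_eq_of_ne hH (Nat.succ_ne_zero w)))
      have hA : batchedClinch X u C W γ T H = batchedClinch X u C W γ T H' := by
        rw [hplay H hw, hplay H' hw', hx]
      rw [sub_le_iff_le_add]
      refine ciSup_le fun y => ?_
      have h1 := action_le_continuationValue (γ := γ) (v := v)
        (A := batchedClinch X u C W γ T) k H' y
      rw [← hl, ← hA] at h1
      rw [← hA] at *
      have h2 : continuationValue γ v (batchedClinch X u C W γ T) k
            (H ++ [(batchedClinch X u C W γ T H, y)])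
          - continuationValue γ v (batchedClinch X u C W γ T) k
            (H' ++ [(batchedClinch X u C W γ T H, y)])
          ≤ γ ^ (H.length + 1 + (w + 1)) * discountHorizon γ := by
        have hlen : (H ++ [(batchedClinch X u C W γ T H, y)]).length = H.length + 1 := by simp
        rcases Nat.eq_zero_or_pos w with rfl | hwpos
        · have := base k (H ++ [(batchedClinch X u C W γ T H, y)])
            (H' ++ [(batchedClinch X u C W γ T H, y)])
          rwa [hlen] at this
        · have hst : ∀ H : History n, (batchState X u C W γ T H).wait = w + 1 →
              ¬ Nat.clog 2 T < (batchState X u C W γ T H).epoch → ∀ p : Strategy n × Fin n,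
              batchState X u C W γ T (H ++ [p])
                = { batchState X u C W γ T H with wait := w } := by
            intro H hH hHe p
            rw [batchState_append, batchRespond_exploit hHe (by rw [hH]; exact Nat.succ_ne_zero w),
              batchFinish_of_wait]
            · simp [hH]
            · simp only [hH, Nat.add_sub_cancel]; exact hwpos.ne'
          have e1 := hst H hw hle (batchedClinch X u C W γ T H, y)
          have e2 := hst H' hw' (he ▸ hle) (batchedClinch X u C W γ T H, y)
          have := ih k (H := H ++ [(batchedClinch X u C W γ T H, y)])
            (H' := H' ++ [(batchedClinch X u C W γ T H, y)]) (by simp [hl]) (by rw [e1])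
            (by rw [e2]) (by rw [e1, e2]; exact he) (by rw [e1]; exact hle)
            (by rw [e1, e2]; exact hx)
          rwa [hlen, show H.length + 1 + 1 + w = H.length + 1 + (w + 1) by ring] at this
      linarith

/-- The attacks that BatchedClinch can count on: exact best responses in the exploit rounds, and
approximate ones in the explore rounds. -/
def BatchState.Truthful (v : Fin n → ℝ → ℝ) (C W : ℝ) (T : ℕ) (s : BatchState n) (y : Fin n) :
    Prop :=
  (Nat.clog 2 T < s.epoch ∨ s.wait ≠ 0 → y ∈ bestResponses v s.exploit) ∧
  (¬ (Nat.clog 2 T < s.epoch ∨ s.wait ≠ 0) → ∀ y',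
    payoff v (clinchQuery s.run) y'
      ≤ payoff v (clinchQuery s.run) y + clinchEps n C (epochDelta C W s.epoch))

lemma IsRational.truthful [Nonempty (Fin n)] (G : IsSecurityGame X u v) (hn : 1 ≤ n)
    (hC : 1 ≤ C) (hW : 0 < W) (hW1 : W ≤ 1) (hγ : 0 < γ) (hγ1 : γ < 1) {B : AgentPolicy n}
    (hB : IsRational γ v (batchedClinch X u C W γ T) T B) {H : History n}
    (hH : OnPath (batchedClinch X u C W γ T) B H) (hT : H.length < T) {y : Fin n}
    (hy : 0 < (B H (batchedClinch X u C W γ T H)).1 y) :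
    (batchState X u C W γ T H).Truthful v C W T y := by
  obtain ⟨k, hk⟩ := Nat.exists_eq_add_of_lt hT
  have hopt := hB.action_optimal hH (k := k) (by omega) hy
  set A := batchedClinch X u C W γ T with hA
  have hcmp : ∀ y', γ ^ (H.length + 1) * (payoff v (A H) y' - payoff v (A H) y)
      ≤ continuationValue γ v A k (H ++ [(A H, y)])
        - continuationValue γ v A k (H ++ [(A H, y')]) := by
    intro y'
    have := action_le_continuationValue (γ := γ) (v := v) (A := A) k H y'
    linarith
  have hpow : 0 < γ ^ (H.length + 1) := by positivity
  set s := batchState X u C W γ T H with hs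
  constructor
  · intro h y'
    have hAs : A H = s.exploit := if_pos h
    have hst : batchState X u C W γ T (H ++ [(A H, y)])
        = batchState X u C W γ T (H ++ [(A H, y')]) := by
      rw [batchState_append, batchState_append]
      unfold batchRespond
      split_ifs with h1 h2
      · rfl
      · exact (h.elim h1 fun h => h h2).elim
      · rfl
    have h1 := hcmp y'
    rw [continuationValue_congr (by simp) hst, sub_self] at h1
    rw [hAs] at h1
    have := nonpos_of_mul_nonpos_right h1 hpow
    linarith
  · intro h y'
    have hAs : A H = clinchQuery s.run := if_neg h
    push Not at h
    have he : ¬ Nat.clog 2 T < s.epoch := not_lt.2 h.1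
    have hst : ∀ z, batchState X u C W γ T (H ++ [(A H, z)]) = _ := fun z =>
      (batchState_append H (A H, z)).trans
        (batchRespond_explore he h.2 (exploitLength_pos hn hC hW hW1 hγ hγ1 _) z)
    have h1 := continuationValue_sub_le (v := v) (T := T) G hn hC hW hW1 hγ hγ1
      (exploitLength n C W γ s.epoch) k (H := H ++ [(A H, y)]) (H' := H ++ [(A H, y')])
      (by simp) (by rw [hst]) (by rw [hst]) (by rw [hst, hst]) (by rw [hst]; exact he)
      (by rw [hst, hst])
    have h2 := (hcmp y').trans h1
    rw [List.length_append, List.length_singleton, add_assoc (H.length + 1), pow_add γ (H.length + 1),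
      mul_assoc] at h2
    have h3 := le_of_mul_le_mul_left h2 hpow
    rw [hAs] at h3
    have h4 := pow_exploitLength_le (n := n) hn hC hW hW1 hγ hγ1 s.epoch
    have h5 : γ ^ (1 + exploitLength n C W γ s.epoch) ≤ γ ^ exploitLength n C W γ s.epoch :=
      pow_le_pow_of_le_one hγ.le hγ1.le (Nat.le_add_left _ _)
    have h6 := mul_le_mul_of_nonneg_right h5
      (zero_le_one.trans (one_le_discountHorizon hγ hγ1))
    linarith

end

/-! ### The regret budget of BatchedClinch -/

section

variable {X : Set (Strategy n)} {u v : Fin n → ℝ → ℝ} {C W γ : ℝ} {T : ℕ}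

/-- A bound on the regret incurred during epoch `φ`: each query costs one explore round, of regret
at most `1`, and the exploit rounds that follow it. -/
noncomputable def epochCost (n : ℕ) (C W γ : ℝ) (φ : ℕ) : ℝ :=
  runBudget n (epochWidth φ) (clinchTol C (epochDelta C W φ)) *
    (1 + exploitLength n C W γ φ * epochWidth φ)

/-- A bound on the regret incurred from a state on, up to the end of the last epoch. -/
noncomputable def BatchState.budget (n : ℕ) (C W γ : ℝ) (T : ℕ) (s : BatchState n) : ℝ :=
  if Nat.clog 2 T < s.epoch then 0
  else s.wait * epochWidth s.epoch +
    s.run.budget C (epochDelta C W s.epoch) (epochWidth s.epoch) *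
      (1 + exploitLength n C W γ s.epoch * epochWidth s.epoch) +
    ∑ φ ∈ Finset.Ioc s.epoch (Nat.clog 2 T), epochCost n C W γ φ

/-- The invariant of BatchedClinch against truthful responses: the run of Clinch is accurate and
the exploit strategy has small regret. -/
structure BatchState.Accurate (X : Set (Strategy n)) (u v : Fin n → ℝ → ℝ) (C W : ℝ)
    (xs : Strategy n) (Vs : ℝ) (s : BatchState n) : Prop where
  run : s.run.Accurate v C (epochDelta C W s.epoch) (epochWidth s.epoch) xs Vs
  exploit : ∀ y ∈ bestResponses v s.exploit, ∀ x ∈ X,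
    stageValue u v x - payoff u s.exploit y ≤ epochWidth s.epoch

lemma runBudget_nonneg {D lam : ℝ} (hn : 1 ≤ n) (hlam : 0 < lam) (hD : lam ≤ D) :
    0 ≤ runBudget n D lam := by
  have hn' : (1 : ℝ) ≤ n := by exact_mod_cast hn
  have h1 := one_le_bisectionBudget hlam hD
  have h2 : 1 ≤ D / lam * (2 * n) :=
    one_le_mul_of_one_le_of_one_le ((one_le_div hlam).2 hD) (by linarith)
  have h3 := Real.log_nonneg h2
  unfold runBudget
  positivity

lemma one_le_weight (n : ℕ) (C W γ : ℝ) (φ : ℕ) :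
    1 ≤ 1 + exploitLength n C W γ φ * epochWidth φ := by
  have := epochWidth_pos φ
  have : 0 ≤ exploitLength n C W γ φ * epochWidth φ := by positivity
  linarith

lemma epochCost_nonneg (hn : 1 ≤ n) (hC : 1 ≤ C) (hW : 0 < W) (hW1 : W ≤ 1) (φ : ℕ) :
    0 ≤ epochCost n C W γ φ := by
  have hC0 : 0 < C := by linarith
  refine mul_nonneg (runBudget_nonneg hn (clinchTol_pos hC0 (epochDelta_pos hC0 hW φ))
    (clinchTol_le_epochWidth hC hW hW1 φ)) (zero_le_one.trans (one_le_weight n C W γ φ))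

lemma batchState_budget_nonneg {xs : Strategy n} {Vs : ℝ} (G : IsSecurityGame X u v) (hn : 1 ≤ n)
    (hC : 1 ≤ C) (hW : 0 < W) (hW1 : W ≤ 1) {s : BatchState n} (hs : s.FeasibleCore X C W)
    (ha : s.Accurate X u v C W xs Vs) : 0 ≤ s.budget n C W γ T := by
  have hC0 : 0 < C := by linarith
  have h1 := clinchState_budget_nonneg G hC0 hn (epochDelta_pos hC0 hW s.epoch)
    (clinchTol_le_epochWidth hC hW hW1 s.epoch) hs.run ha.run
  have h2 := one_le_weight n C W γ s.epoch
  have h3 := epochWidth_pos s.epoch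
  have h4 : 0 ≤ ∑ φ ∈ Finset.Ioc s.epoch (Nat.clog 2 T), epochCost n C W γ φ :=
    Finset.sum_nonneg fun φ _ => epochCost_nonneg hn hC hW hW1 φ
  unfold BatchState.budget
  split_ifs
  · exact le_rfl
  · have h5 := mul_nonneg h1 (zero_le_one.trans h2)
    positivity

variable {xs : Strategy n} {Vs : ℝ}

lemma payoff_mem (G : IsSecurityGame X u v) {x : Strategy n} (hx : x ∈ X) (y : Fin n) :
    payoff u x y ∈ Icc (0 : ℝ) 1 :=
  G.u_mapsTo y (G.mem_cube x hx y)

lemma epochWidth_one : epochWidth 1 = 1 := by norm_num [epochWidth]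

lemma batchInit_accurate [Nonempty (Fin n)] (hc : IsConservative X v W xs Vs)
    (G : IsSecurityGame X u v) (hR : IsRegular X u v C W) (hn : 1 ≤ n) :
    (batchInit X C W).Accurate X u v C W xs Vs ∧
      (batchInit X C W).budget n C W γ T
        ≤ ∑ φ ∈ Finset.Ioc 0 (Nat.clog 2 T), epochCost n C W γ φ := by
  have hW := hR.width_pos
  have hW1 := hR.width_le_one G
  have hC := hR.one_le
  have hδ := epochDelta_pos hR.pos hW 1
  obtain ⟨h1, h2⟩ := clinchInit_accurate hc G hR hn (D := epochWidth 1) hδ (lo := 0) (hi := 1)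
    le_rfl (first_box hC hW hW1) (by simp [epochWidth_one])
    (fun y => (G.mem_cube xs hc.mem y).1) (fun y => (G.mem_cube xs hc.mem y).2)
  refine ⟨⟨h1, fun y _ x hx => ?_⟩, ?_⟩
  · have h3 := stageValue_le_one G hx
    have h4 := (payoff_mem G (zero_mem G) y).1
    simp only [batchInit, epochWidth_one]
    linarith
  · unfold BatchState.budget
    split_ifs with h
    · exact Finset.sum_nonneg fun φ _ => epochCost_nonneg hn hC hW hW1 φ
    · have h3 : 1 ≤ Nat.clog 2 T := not_lt.1 h
      rw [← Finset.sum_Ioc_consecutive _ (Nat.zero_le 1) h3, Nat.Ioc_succ_singleton,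
        Finset.sum_singleton]
      simp only [batchInit, Nat.cast_zero, zero_mul, zero_add]
      have := mul_le_mul_of_nonneg_right h2 (zero_le_one.trans (one_le_weight n C W γ 1))
      unfold epochCost
      linarith

/-- At the end of an epoch the next box contains the conservative strategy, and the new exploit
strategy has half the regret bound. -/
lemma batchFinish_accurate [Nonempty (Fin n)] (hc : IsConservative X v W xs Vs)
    (G : IsSecurityGame X u v) (hR : IsRegular X u v C W) (hn : 1 ≤ n) {s : BatchState n}
    (hs : s.FeasibleCore X C W) (ha : s.Accurate X u v C W xs Vs)
    (he : ¬ Nat.clog 2 T < s.epoch) :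
    (batchFinish X u C W s).Accurate X u v C W xs Vs ∧
      (batchFinish X u C W s).budget n C W γ T ≤ s.budget n C W γ T := by
  have hW := hR.width_pos
  have hW1 := hR.width_le_one G
  have hC := hR.one_le
  by_cases hw : s.wait = 0
  · by_cases hd : ∃ xhat, s.run = .done xhat
    · obtain ⟨xhat, hd⟩ := hd
      have hx : xhat ∈ X := by
        have := hs.run
        rw [hd] at this
        exact this
      have hclose : ∀ y, |xhat y - xs y| ≤ epochDelta C W s.epoch := by
        have := ha.run
        rw [hd] at this
        exact this
      rw [batchFinish_done hw hd]
      obtain ⟨hb1, hb2, hb3⟩ := box_spec G hC hW hW1 s.epoch hx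
      obtain ⟨h1, h2⟩ := clinchInit_accurate hc G hR hn (D := epochWidth (s.epoch + 1))
        (epochDelta_pos hR.pos hW (s.epoch + 1)) hb2 hb3 (fun y => by
          have h3 := epochDelta_le hC hW hW1 s.epoch
          have h4 := min_le_left (xhat y + epochDelta C W s.epoch) 1
          have h5 := le_max_left (xhat y - epochDelta C W s.epoch) 0
          linarith)
        (fun y => max_le (by linarith [(abs_le.1 (hclose y)).2]) (G.mem_cube xs hc.mem y).1)
        (fun y => le_min (by linarith [(abs_le.1 (hclose y)).1]) (G.mem_cube xs hc.mem y).2)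
      refine ⟨⟨h1, fun y hy x hxX => ?_⟩, ?_⟩
      · have h3 := hc.perturb_regret G hR hx (epochLam_pos hR.pos _) (epochLam_le_one hC _)
          hclose hy hxX
        refine h3.trans ?_
        have h4 : C * W * epochLam C s.epoch = W * (1 / 2 ^ s.epoch) := by
          have := hR.pos
          unfold epochLam; field_simp
        have h5 : epochWidth (s.epoch + 1) = 1 / 2 ^ s.epoch := by
          unfold epochWidth; rw [pow_succ]; field_simp
        simp only [h4, h5]
        exact mul_le_of_le_one_left (by positivity) hW1
      · have hsb : s.budget n C W γ T
            = ∑ φ ∈ Finset.Ioc s.epoch (Nat.clog 2 T), epochCost n C W γ φ := by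
          unfold BatchState.budget
          rw [if_neg he, hw, hd]
          simp [ClinchState.budget]
        rw [hsb]
        unfold BatchState.budget
        split_ifs with h
        · exact Finset.sum_nonneg fun φ _ => epochCost_nonneg hn hC hW hW1 φ
        · have h3 : s.epoch + 1 ≤ Nat.clog 2 T := not_lt.1 h
          rw [← Finset.sum_Ioc_consecutive _ (Nat.le_succ s.epoch) h3, Nat.Ioc_succ_singleton,
            Finset.sum_singleton]
          simp only [Nat.cast_zero, zero_mul, zero_add]
          have := mul_le_mul_of_nonneg_right h2
            (zero_le_one.trans (one_le_weight n C W γ (s.epoch + 1)))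
          unfold epochCost
          linarith
    · push Not at hd
      rw [batchFinish_of_run hd]
      exact ⟨ha, le_rfl⟩
  · rw [batchFinish_of_wait hw]
    exact ⟨ha, le_rfl⟩

/-- In every round answered truthfully the regret is paid by the drop of the budget, up to the
regret of the final exploit strategy. -/
lemma batchRespond_accurate [Nonempty (Fin n)] (hc : IsConservative X v W xs Vs)
    (G : IsSecurityGame X u v) (hR : IsRegular X u v C W) (hn : 1 ≤ n) (hγ : 0 < γ) (hγ1 : γ < 1)
    {s : BatchState n} (hs : s.Feasible X C W) (ha : s.Accurate X u v C W xs Vs) {y : Fin n}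
    (hy : s.Truthful v C W T y) :
    (batchRespond X u C W γ T s y).Accurate X u v C W xs Vs ∧
      ∀ x ∈ X, stageValue u v x - payoff u (batchPlay T s) y +
          (batchRespond X u C W γ T s y).budget n C W γ T
        ≤ s.budget n C W γ T + epochWidth (Nat.clog 2 T + 1) := by
  have hW := hR.width_pos
  have hW1 := hR.width_le_one G
  have hC := hR.one_le
  have hlast := (epochWidth_pos (Nat.clog 2 T + 1)).le
  -- The three cases are: play after the last epoch, an explore round, an exploit round of a batch.
  by_cases he : Nat.clog 2 T < s.epoch
  · have hresp : batchRespond X u C W γ T s y = s := if_pos he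
    rw [hresp]
    refine ⟨ha, fun x hx => ?_⟩
    have h1 := ha.exploit y (hy.1 (Or.inl he)) x hx
    have hplay : batchPlay T s = s.exploit := if_pos (Or.inl he)
    have h2 : epochWidth s.epoch ≤ epochWidth (Nat.clog 2 T + 1) := by
      unfold epochWidth
      exact div_le_div_of_nonneg_left (by norm_num) (by positivity)
        (pow_le_pow_right₀ (by norm_num) he)
    rw [hplay]
    linarith
  · by_cases hw : s.wait = 0
    · have hno : ¬ (Nat.clog 2 T < s.epoch ∨ s.wait ≠ 0) := by simp [he, hw]
      have hplay : batchPlay T s = clinchQuery s.run := if_neg hno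
      have hδ := epochDelta_pos hR.pos hW s.epoch
      obtain ⟨h1, h2⟩ := clinchRespond_accurate hc G hR hδ
        (clinchTol_le_epochWidth hC hW hW1 s.epoch) hs.run ha.run (hs.not_done hw) (hy.2 hno)
      rw [batchRespond_explore he hw (exploitLength_pos hn hC hW hW1 hγ hγ1 _)]
      refine ⟨⟨h1, ha.exploit⟩, fun x hx => ?_⟩
      have h3 := stageValue_le_one G hx
      have h4 := (payoff_mem G (batchPlay_mem (T := T) G hn hC hW hs) y).1
      have h5 := mul_le_mul_of_nonneg_right h2
        (zero_le_one.trans (one_le_weight n C W γ s.epoch))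
      unfold BatchState.budget
      simp only [if_neg he, hw, Nat.cast_zero, zero_mul, zero_add]
      linarith
    · have hplay : batchPlay T s = s.exploit := if_pos (Or.inr hw)
      rw [batchRespond_exploit he hw, hplay]
      have hcore : BatchState.FeasibleCore X C W { s with wait := s.wait - 1 } :=
        ⟨hs.epoch_pos, hs.run, hs.exploit⟩
      obtain ⟨h1, h2⟩ := batchFinish_accurate (γ := γ) (T := T) hc G hR hn hcore
        ⟨ha.run, ha.exploit⟩ he
      refine ⟨h1, fun x hx => ?_⟩
      have h3 := ha.exploit y (hy.1 (Or.inr hw)) x hx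
      have h4 : BatchState.budget n C W γ T { s with wait := s.wait - 1 }
          + epochWidth s.epoch = s.budget n C W γ T := by
        unfold BatchState.budget
        simp only [if_neg he]
        rw [Nat.cast_sub (Nat.one_le_iff_ne_zero.2 hw)]
        push_cast
        ring
      linarith

/-- The regret against a rational agent is bounded on every history of positive probability. -/
lemma regret_onPath_le [Nonempty (Fin n)] (hc : IsConservative X v W xs Vs)
    (G : IsSecurityGame X u v) (hR : IsRegular X u v C W) (hn : 1 ≤ n) (hγ : 0 < γ) (hγ1 : γ < 1)
    {B : AgentPolicy n} (hB : IsRational γ v (batchedClinch X u C W γ T) T B) {x : Strategy n}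
    (hx : x ∈ X) {H : History n} (hH : OnPath (batchedClinch X u C W γ T) B H)
    (hT : H.length ≤ T) :
    (batchState X u C W γ T H).Accurate X u v C W xs Vs ∧
      ∑ t : Fin H.length, (stageValue u v x - payoff u (H.get t).1 (H.get t).2) +
          (batchState X u C W γ T H).budget n C W γ T
        ≤ ∑ φ ∈ Finset.Ioc 0 (Nat.clog 2 T), epochCost n C W γ φ +
          H.length * epochWidth (Nat.clog 2 T + 1) := by
  have hW := hR.width_pos
  have hW1 := hR.width_le_one G
  have hC := hR.one_le
  induction hH with
  | nil =>
    obtain ⟨h1, h2⟩ := batchInit_accurate (γ := γ) (T := T) hc G hR hn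
    exact ⟨h1, by simpa [batchState] using h2⟩
  | snoc H y hH hy ih =>
    rw [List.length_append, List.length_singleton] at hT
    obtain ⟨h1, h2⟩ := ih (by omega)
    obtain ⟨h3, h4⟩ := batchRespond_accurate hc G hR hn hγ hγ1
      (batchState_feasible (γ := γ) (T := T) G hC hW hW1 H) h1
      (hB.truthful G hn hC hW hW1 hγ hγ1 hH (by omega) hy)
    rw [batchState_append]
    refine ⟨h3, ?_⟩
    have h5 := h4 x hx
    rw [sum_history_append H _ fun _ q => stageValue u v x - payoff u q.1 q.2,
      List.length_append, List.length_singleton]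
    push_cast
    change _ - payoff u (batchedClinch X u C W γ T H) y + _ ≤ _ at h5
    linarith

lemma stackelbergRegret_le [Nonempty (Fin n)] (G : IsSecurityGame X u v)
    (hR : IsRegular X u v C W) (hn : 1 ≤ n) (hγ : 0 < γ) (hγ1 : γ < 1)
    {B : AgentPolicy n} (hB : IsRational γ v (batchedClinch X u C W γ T) T B) :
    stackelbergRegret X u v (batchedClinch X u C W γ T) B T
      ≤ ∑ φ ∈ Finset.Ioc 0 (Nat.clog 2 T), epochCost n C W γ φ + 1 := by
  have hW := hR.width_pos
  have hW1 := hR.width_le_one G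
  have hC := hR.one_le
  obtain ⟨xs, Vs, hc⟩ := exists_conservative G hR
  have : Nonempty X := G.nonempty.to_subtype
  refine ciSup_le fun x => ?_
  rw [← expect_const (A := batchedClinch X u C W γ T) (B := B) T
    (∑ φ ∈ Finset.Ioc 0 (Nat.clog 2 T), epochCost n C W γ φ + 1)]
  refine expect_mono_onPath fun H hH hl => ?_
  obtain ⟨h1, h2⟩ := regret_onPath_le hc G hR hn hγ hγ1 hB x.2 hH hl.le
  have h3 := batchState_budget_nonneg (γ := γ) (T := T) G hn hC hW hW1
    (batchState_feasible (γ := γ) (T := T) G hC hW hW1 H).toFeasibleCore h1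
  have h4 : (H.length : ℝ) * epochWidth (Nat.clog 2 T + 1) ≤ 1 := by
    have h5 : (T : ℝ) ≤ 2 ^ Nat.clog 2 T := by exact_mod_cast Nat.le_pow_clog (by norm_num) T
    unfold epochWidth
    rw [hl, pow_succ, mul_div_assoc', div_le_one (by positivity)]
    linarith
  linarith

end

/-! ### Numerical estimates -/

section

variable {C W γ : ℝ} {T : ℕ}

/-- Numerical constants are absorbed into `log A` by means of `2 ≤ A`. -/
lemma log_mul_pow_le {A b : ℝ} (hA : 2 ≤ A) (k m : ℕ) (hb : 0 < b) (hb' : b ≤ 2 ^ k * A ^ m) :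
    Real.log b ≤ (k + m) * Real.log A := by
  have hA0 : 0 < A := by linarith
  have h1 : Real.log 2 ≤ Real.log A := Real.log_le_log (by norm_num) hA
  calc Real.log b ≤ Real.log (2 ^ k * A ^ m) := Real.log_le_log hb hb'
    _ = k * Real.log 2 + m * Real.log A := by
      rw [Real.log_mul (by positivity) (by positivity), Real.log_pow, Real.log_pow]
    _ ≤ _ := by nlinarith [mul_le_mul_of_nonneg_left h1 (Nat.cast_nonneg (α := ℝ) k)]

lemma runBudget_le (hn : 1 ≤ n) (hC : 1 ≤ C) (hW : 0 < W) (hW1 : W ≤ 1) (hA : 2 ≤ C * n / W)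
    (φ : ℕ) :
    runBudget n (epochWidth φ) (clinchTol C (epochDelta C W φ))
      ≤ 220 * (n * Real.log (C * n / W)) := by
  have hn' : (1 : ℝ) ≤ n := by exact_mod_cast hn
  have hC0 : 0 < C := by linarith
  have hpow : C ^ 5 * n / W ≤ (C * n / W) ^ 5 := by
    rw [div_pow, mul_pow]
    have h1 : (n : ℝ) ≤ n ^ 5 := le_self_pow₀ hn' (by norm_num)
    have h2 : W ^ 5 ≤ W := pow_le_of_le_one hW.le hW1 (by norm_num)
    gcongr
  have hle : 48 * C ^ 5 / W ≤ 48 * (C ^ 5 * n / W) := by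
    rw [mul_div_assoc]
    gcongr
    exact le_mul_of_one_le_right (by positivity) hn'
  have h2 : (2 : ℝ) ≤ 3 * Real.log (C * n / W) := by
    have := Real.log_le_log (by norm_num) hA
    linarith [Real.log_two_gt_d9]
  have hA5 : 0 ≤ (C * n / W) ^ 5 := by positivity
  have h3 := log_mul_pow_le hA 7 5 (b := 48 * C ^ 5 / W * (2 * n)) (by positivity) (by
    have : 48 * C ^ 5 / W * (2 * n) = 96 * (C ^ 5 * n / W) := by field_simp; norm_num
    rw [this]
    linarith)
  have h4 := log_mul_pow_le hA 7 5 (b := 48 * C ^ 5 / W) (by positivity) (by linarith)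
  push_cast at h3 h4
  set Λ := Real.log (C * n / W)
  unfold runBudget bisectionBudget
  rw [epochWidth_div hC0 hW]
  have h5 : (n : ℝ) * (Real.log (48 * C ^ 5 / W * (2 * n)) + 2) ≤ n * (15 * Λ) :=
    mul_le_mul_of_nonneg_left (by linarith) (by linarith)
  have h6 : (n : ℝ) * (8 * Real.log (48 * C ^ 5 / W) + 1) ≤ n * (98 * Λ) :=
    mul_le_mul_of_nonneg_left (by linarith) (by linarith)
  have h7 : 1 ≤ 2 * (n * Λ) := by nlinarith
  linarith

lemma exploitLength_le (hn : 1 ≤ n) (hC : 1 ≤ C) (hW : 0 < W) (hW1 : W ≤ 1)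
    (hγ : 0 < γ) (hγ1 : γ < 1) (hA : 2 ≤ C * n * discountHorizon γ / W) {φ : ℕ} (hφ : 1 ≤ φ) :
    (exploitLength n C W γ φ : ℝ)
      ≤ 17 * (discountHorizon γ * Real.log (C * n * discountHorizon γ / W)) * φ := by
  have hn' : (1 : ℝ) ≤ n := by exact_mod_cast hn
  have hφ' : (1 : ℝ) ≤ φ := by exact_mod_cast hφ
  have hC0 : 0 < C := by linarith
  have hT := one_le_discountHorizon hγ hγ1
  have hT0 : 0 < discountHorizon γ := by linarith
  have harg := one_lt_log_argument hn hC hW hW1 hγ hγ1 φ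
  set Tγ := discountHorizon γ
  have h1 : 200 * Tγ * C ^ 5 * n / (W * epochLam C φ) = 200 * 2 ^ φ * (C ^ 6 * n * Tγ / W) := by
    unfold epochLam; field_simp
  have h2 : C ^ 6 * n * Tγ / W ≤ (C * n * Tγ / W) ^ 6 := by
    rw [div_pow, mul_pow, mul_pow]
    have h1 : (n : ℝ) ≤ n ^ 6 := le_self_pow₀ hn' (by norm_num)
    have h2 : W ^ 6 ≤ W := pow_le_of_le_one hW.le hW1 (by norm_num)
    have h3 : Tγ ≤ Tγ ^ 6 := le_self_pow₀ hT (by norm_num)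
    gcongr
  have h3 := log_mul_pow_le hA (8 + φ) 6 (b := 200 * Tγ * C ^ 5 * n / (W * epochLam C φ))
    (by linarith) (by
      rw [h1, pow_add]
      have : (200 : ℝ) * 2 ^ φ ≤ 2 ^ 8 * 2 ^ φ :=
        mul_le_mul_of_nonneg_right (by norm_num) (by positivity)
      gcongr)
  push_cast at h3
  have hlog : (2 : ℝ) ≤ 3 * Real.log (C * n * Tγ / W) := by
    have := Real.log_le_log (by norm_num) hA
    linarith [Real.log_two_gt_d9]
  set Λ := Real.log (C * n * Tγ / W)
  have h4 := Nat.ceil_lt_add_one (mul_nonneg hT0.le (Real.log_nonneg harg.le))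
  have h5 : Real.log (200 * Tγ * C ^ 5 * n / (W * epochLam C φ)) ≤ 15 * Λ * φ := by nlinarith
  have h6 : 1 ≤ 2 * (Tγ * Λ) := by nlinarith
  have h7 : Tγ * Λ ≤ Tγ * Λ * φ := le_mul_of_one_le_right (by nlinarith) hφ'
  have h8 := mul_le_mul_of_nonneg_left h5 hT0.le
  have h9 : (exploitLength n C W γ φ : ℝ)
      < Tγ * Real.log (200 * Tγ * C ^ 5 * n / (W * epochLam C φ)) + 1 := h4
  nlinarith

lemma sum_mul_epochWidth_le (m : ℕ) : ∑ φ ∈ Finset.Ioc 0 m, (φ : ℝ) * epochWidth φ ≤ 4 := by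
  have h : ∑ φ ∈ Finset.Ioc 0 m, (φ : ℝ) * epochWidth φ = 4 - (2 * m + 4) / 2 ^ m := by
    induction m with
    | zero => simp
    | succ m ih =>
      rw [Finset.sum_Ioc_succ_top (Nat.zero_le m), ih]
      unfold epochWidth
      push_cast
      field_simp
      ring
  rw [h]
  have : (0 : ℝ) ≤ (2 * m + 4) / 2 ^ m := by positivity
  linarith

lemma clog_le (T : ℕ) : (Nat.clog 2 T : ℝ) ≤ 3 * Real.log T := by
  rcases lt_or_ge T 2 with h | h
  · have : T = 0 ∨ T = 1 := by omega
    rcases this with rfl | rfl <;> simp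
  · have h1 : 0 < Nat.clog 2 T := Nat.clog_pos (by norm_num) h
    have h2 := Nat.pow_pred_clog_lt_self (b := 2) (by norm_num) h
    have h3 : ((2 : ℝ)) ^ (Nat.clog 2 T - 1) ≤ T := by exact_mod_cast h2.le
    have h4 := Real.log_le_log (by positivity) h3
    rw [Real.log_pow, Nat.cast_sub h1] at h4
    have h5 : Real.log 2 ≤ Real.log T :=
      Real.log_le_log (by norm_num) (by exact_mod_cast h)
    push_cast at h4
    nlinarith [Real.log_two_gt_d9]

lemma sum_epochCost_le (hn : 1 ≤ n) (hC : 1 ≤ C) (hW : 0 < W) (hW1 : W ≤ 1) (hγ : 0 < γ)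
    (hγ1 : γ < 1) (hA : 2 ≤ C * n / W) :
    ∑ φ ∈ Finset.Ioc 0 (Nat.clog 2 T), epochCost n C W γ φ + 1
      ≤ 15000 * (n * Real.log (C * n / W) * Real.log T +
          n * discountHorizon γ * Real.log (C * n * discountHorizon γ / W) ^ 2) := by
  have hn' : (1 : ℝ) ≤ n := by exact_mod_cast hn
  have hT := one_le_discountHorizon hγ hγ1
  have hAA : C * n / W ≤ C * n * discountHorizon γ / W :=
    div_le_div_of_nonneg_right (le_mul_of_one_le_right (by positivity) hT) hW.le
  have hΛ : Real.log 2 ≤ Real.log (C * n / W) := Real.log_le_log (by norm_num) hA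
  have hΛΛ : Real.log (C * n / W) ≤ Real.log (C * n * discountHorizon γ / W) :=
    Real.log_le_log (by linarith) hAA
  have hrun := runBudget_le hn hC hW hW1 hA
  have hexp := fun (φ : ℕ) (hφ : 1 ≤ φ) =>
    exploitLength_le hn hC hW hW1 hγ hγ1 (hA.trans hAA) hφ
  have hlog2 := Real.log_two_gt_d9
  set Λ := Real.log (C * n / W)
  set Λ' := Real.log (C * n * discountHorizon γ / W)
  set Tγ := discountHorizon γ
  have hΛ0 : 0 < Λ := by linarith
  have hΛ'0 : 0 < Λ' := by linarith
  have hT0 : 0 < Tγ := by linarith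
  have hterm : ∀ φ ∈ Finset.Ioc 0 (Nat.clog 2 T), epochCost n C W γ φ
      ≤ 220 * (n * Λ) + 3740 * (n * Λ * (Tγ * Λ')) * (φ * epochWidth φ) := by
    intro φ hφ
    have h1 := hexp φ (Finset.mem_Ioc.1 hφ).1
    have hw := epochWidth_pos φ
    have h2 := mul_le_mul_of_nonneg_right h1 hw.le
    calc epochCost n C W γ φ
        ≤ 220 * (n * Λ) * (1 + exploitLength n C W γ φ * epochWidth φ) :=
          mul_le_mul_of_nonneg_right (hrun φ) (by positivity)
      _ ≤ 220 * (n * Λ) * (1 + 17 * (Tγ * Λ') * φ * epochWidth φ) :=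
          mul_le_mul_of_nonneg_left (by linarith) (by positivity)
      _ = _ := by ring
  have hsum := Finset.sum_le_sum hterm
  rw [Finset.sum_add_distrib, Finset.sum_const, Nat.card_Ioc, nsmul_eq_mul, Nat.sub_zero,
    ← Finset.mul_sum _ _ (3740 * (n * Λ * (Tγ * Λ')))] at hsum
  have h1 := sum_mul_epochWidth_le (Nat.clog 2 T)
  have h2 := clog_le T
  have hnΛ : 0 ≤ n * Λ := by positivity
  have hTΛ : 0 ≤ Tγ * Λ' := by positivity
  have h3 : 3740 * (n * Λ * (Tγ * Λ')) * ∑ φ ∈ Finset.Ioc 0 (Nat.clog 2 T), (φ : ℝ) * epochWidth φ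
      ≤ 3740 * (n * Λ * (Tγ * Λ')) * 4 :=
    mul_le_mul_of_nonneg_left h1 (by positivity)
  have h4 : (Nat.clog 2 T : ℝ) * (220 * (n * Λ)) ≤ 3 * Real.log T * (220 * (n * Λ)) :=
    mul_le_mul_of_nonneg_right h2 (by positivity)
  have h5 : n * Λ * (Tγ * Λ') ≤ n * Λ' * (Tγ * Λ') :=
    mul_le_mul_of_nonneg_right (mul_le_mul_of_nonneg_left hΛΛ (by linarith)) hTΛ
  have h6 : 1 ≤ 3 * (n * Tγ * Λ' ^ 2) := by
    have h7 : 1 ≤ n * Tγ := one_le_mul_of_one_le_of_one_le hn' hT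
    nlinarith
  have h7 : 0 ≤ Real.log T := Real.log_natCast_nonneg T
  have h8 : 0 ≤ n * Λ * Real.log T := by positivity
  have h9 : n * Λ' * (Tγ * Λ') = n * Tγ * Λ' ^ 2 := by ring
  linarith

end

end SecurityGame

theorem mainTheorem3 :
    ∃ K : ℝ, 0 < K ∧
      ∀ (n : ℕ) (X : Set (SecurityGame.Strategy n)) (u v : Fin n → ℝ → ℝ) (C W γ : ℝ) (T : ℕ),
        SecurityGame.IsSecurityGame X u v →
        SecurityGame.IsRegular X u v C W →
        2 ≤ C * n / W → 0 < γ → γ < 1 →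
        (∀ H : SecurityGame.History n, SecurityGame.batchedClinch X u C W γ T H ∈ X) ∧
        ∀ B : SecurityGame.AgentPolicy n,
          SecurityGame.IsRational γ v (SecurityGame.batchedClinch X u C W γ T) T B →
          SecurityGame.stackelbergRegret X u v (SecurityGame.batchedClinch X u C W γ T) B T ≤
            K * (n * Real.log (C * n / W) * Real.log T +
              n * SecurityGame.discountHorizon γ *
                Real.log (C * n * SecurityGame.discountHorizon γ / W) ^ 2) := by
  refine ⟨15000, by norm_num, fun n X u v C W γ T G hR hA hγ hγ1 => ?_⟩
  have hn : 1 ≤ n := by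
    by_contra! h
    have : n = 0 := by omega
    subst this
    norm_num at hA
  have : Nonempty (Fin n) := ⟨⟨0, hn⟩⟩
  have hW1 := hR.width_le_one G
  exact ⟨SecurityGame.batchedClinch_mem G hn hR.one_le hR.width_pos hW1, fun B hB =>
    (SecurityGame.stackelbergRegret_le G hR hn hγ hγ1 hB).trans
      (SecurityGame.sum_epochCost_le hn hR.one_le hR.width_pos hW1 hγ hγ1 hA)⟩
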